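/- Let $k$ be a field and let $s\ge 0$, $n\ge 1$ be integers. For a commutative $k$-algebra $R$, consider formal series $f=\sum_w f_w z_w$ in $s$ non-commuting variables without constant term, with $f_w\in R$, indexed by the non-empty words $w$ over $\{1,\dots,s\}$; $|w|$ denotes the length of $w$. The boxed convolution of two such series is $$(f\boxtimes g)_w=\sum_{\pi\in NC(|w|)}\ \prod_{V\in\pi}f_{w|V}\ \prod_{V\in K(\pi)}g_{w|V},$$ where $NC(m)$ is the set of non-crossing partitions of $\{1,\dots,m\}$, $w|V$ is the subword of $w$ at the positions in the block $V$, and $K(\pi)$ is the Kreweras complement of $\pi$, i.e. the largest non-crossing partition of $\{\bar1,\dots,\bar m\}$ such that $\pi\cup K(\pi)$ is non-crossing on $1<\bar1<2<\bar2<\dots<m<\bar m$. Let $$(\mathfrak G^s)_n(R)=\Big\{\sum_{1\le|w|\le n}f_wz_w : f_1,\dots,f_s\in R^\times\Big\},\qquad (\mathfrak G^s_+)_n(R)=\Big\{\sum_{1\le|w|\le n}f_wz_w : f_1=\dots=f_s=1\Big\},$$ with multiplication $\boxtimes$ followed by deleting all terms with $|w|>n$, and let $(\mathfrak G^s_+)_{n,j}(R)$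 be the set of $f\in(\mathfrak G^s_+)_n(R)$ with $f_w=0$ for $2\le|w|\le j$. Then $(\mathfrak G^s)_n(R)$ is a group for every $R$, functorially in $R$, and $(\mathfrak G^s_+)_n$ is a subgroup functor of it. Moreover: 1. For $2\le j\le n$, $(\mathfrak G^s_+)_{n,j}(R)$ is a normal subgroup of $(\mathfrak G^s_+)_n(R)$. Put $G_0=(\mathfrak G^s_+)_n$ and $G_i=(\mathfrak G^s_+)_{n,i+1}$ for $1\le i\le n-1$. Then $G_0\supseteq G_1\supseteq\dots\supseteq G_{n-1}=\{1\}$ is a normal series of $G_0$, and there are isomorphisms, natural in $R$, $$G_i(R)/G_{i+1}(R)\cong\mathbb G_a^{\,s^{i+2}}(R)=(R^{s^{i+2}},+)\qquad(0\le i\le n-2).$$ 2. $(\mathfrak G^s)_n$ is a split solvable algebraic group over $k$: it is represented by a finitely generated $k$-algebra and has a finite subnormal series of closed subgroups $H_0=(\mathfrak G^s)_n\supseteq H_1\supseteq\dots\supseteq H_m=\{1\}$ such that, for each $i<m$, the group functor $R\mapsto H_i(R)/H_{i+1}(R)$ is isomorphic to $R\mapsto\mathbb G_a(R)=(R,+)$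 or to $R\mapsto\mathbb G_m(R)=R^\times$. -/

import Mathlib

open CategoryTheory

universe u

namespace BoxedConvolution

/-! ## Non-crossing partitions and the Kreweras complement -/

/-- A relation on an ordered set has no crossing `p₁ < q₁ < p₂ < q₂`, `p₁ ∼ p₂`, `q₁ ∼ q₂`,
`q₁ ≁ p₂`. -/
def NoCrossing {α : Type*} [LT α] (r : α → α → Prop) : Prop :=
  ∀ p₁ q₁ p₂ q₂ : α, p₁ < q₁ → q₁ < p₂ → p₂ < q₂ → r p₁ p₂ → r q₁ q₂ → r q₁ p₂

/-- Partitions of the ordered set of `n` positions, ordered by refinement. -/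
abbrev Part (n : ℕ) : Type := Finpartition (Finset.univ : Finset (Fin n))

/-- `p` and `q` lie in the same block of `π`. -/
def Part.Rel {n : ℕ} (π : Part n) (p q : Fin n) : Prop := ∃ V ∈ π.parts, p ∈ V ∧ q ∈ V

instance {n : ℕ} (π : Part n) : DecidableRel π.Rel :=
  fun p q => inferInstanceAs (Decidable (∃ V ∈ π.parts, p ∈ V ∧ q ∈ V))

def Part.NonCrossing {n : ℕ} (π : Part n) : Prop := NoCrossing π.Rel

instance {n : ℕ} : DecidablePred (Part.NonCrossing (n := n)) :=
  fun π => inferInstanceAs (Decidable (∀ p₁ q₁ p₂ q₂ : Fin n,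
    p₁ < q₁ → q₁ < p₂ → p₂ < q₂ → π.Rel p₁ p₂ → π.Rel q₁ q₂ → π.Rel q₁ p₂))

/-- The set `NC(n)`. -/
def NC (n : ℕ) : Finset (Part n) := Finset.univ.filter Part.NonCrossing

/-- The equivalence relation of the partition `π ∪ σ` of `1 < 1̄ < 2 < 2̄ < ⋯ < n < n̄`, where
`π` lives on the letters `i = (i, false)` and `σ` on the letters `ī = (i, true)`. -/
def doubledRel {n : ℕ} (π σ : Part n) (x y : Fin n ×ₗ Bool) : Prop :=
  ((ofLex x).2 = false ∧ (ofLex y).2 = false ∧ π.Rel (ofLex x).1 (ofLex y).1) ∨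
  ((ofLex x).2 = true ∧ (ofLex y).2 = true ∧ σ.Rel (ofLex x).1 (ofLex y).1)

/-- `i` and `j` are equivalent if `{min(i,j)+1, …, max(i,j)}` is a union of blocks of `π`
(note that `p` lies in this interval iff exactly one of `p ≤ i`, `p ≤ j` holds). -/
def krewerasSetoid {n : ℕ} (π : Part n) : Setoid (Fin n) where
  r i j := ∀ p q : Fin n, π.Rel p q → ((p ≤ i ↔ p ≤ j) ↔ (q ≤ i ↔ q ≤ j))
  iseqv :=
    { refl := fun i p q _ => by simp
      symm := fun {i j} h p q hpq => by have := h p q hpq; tauto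
      trans := fun {i j l} h h' p q hpq => by
        have h1 := h p q hpq
        have h2 := h' p q hpq
        tauto }

instance {n : ℕ} (π : Part n) : DecidableRel (krewerasSetoid π).r :=
  fun i j => inferInstanceAs (Decidable
    (∀ p q : Fin n, π.Rel p q → ((p ≤ i ↔ p ≤ j) ↔ (q ≤ i ↔ q ≤ j))))

/-- The Kreweras complement `K(π)`; `isGreatest_kreweras` shows that, for non-crossing `π`, it is
the largest non-crossing `σ` for which `π ∪ σ` is a non-crossing partition of the doubled set. -/
def kreweras {n : ℕ} (π : Part n) : Part n := Finpartition.ofSetoid (krewerasSetoid π)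

theorem rel_iff_mem_part {n : ℕ} (π : Part n) (p q : Fin n) : π.Rel p q ↔ p ∈ π.part q :=
  π.mem_part_iff_exists.symm

theorem Part.Rel.refl {n : ℕ} (π : Part n) (p : Fin n) : π.Rel p p := by
  rw [rel_iff_mem_part]; simp

theorem Part.Rel.symm {n : ℕ} {π : Part n} {p q : Fin n} (h : π.Rel p q) : π.Rel q p := by
  obtain ⟨V, hV, hp, hq⟩ := h
  exact ⟨V, hV, hq, hp⟩

theorem kreweras_rel {n : ℕ} (π : Part n) (i j : Fin n) :
    (kreweras π).Rel i j ↔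
      ∀ p q : Fin n, π.Rel p q → ((p ≤ i ↔ p ≤ j) ↔ (q ≤ i ↔ q ≤ j)) := by
  rw [rel_iff_mem_part]
  refine (Finpartition.mem_part_ofSetoid_iff_rel (s := krewerasSetoid π) (a := j) (b := i)).trans ?_
  exact ⟨fun h => (krewerasSetoid π).symm' h, fun h => (krewerasSetoid π).symm' h⟩

theorem le_of_rel {n : ℕ} {π σ : Part n} (h : ∀ p q, π.Rel p q → σ.Rel p q) : π ≤ σ := by
  intro V hV
  obtain ⟨x, hx⟩ := π.nonempty_of_mem_parts hV
  refine ⟨σ.part x, σ.part_mem.2 (Finset.mem_univ x), fun y hy => ?_⟩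
  exact (rel_iff_mem_part σ y x).1 (h y x ⟨V, hV, hy, hx⟩)

theorem isGreatest_kreweras {n : ℕ} (π : Part n) (hπ : π.NonCrossing) :
    IsGreatest {σ : Part n | σ.NonCrossing ∧ NoCrossing (doubledRel π σ)} (kreweras π) := by
  have hK : (kreweras π).NonCrossing := by
    intro i k j l hik hkj hjl hij hkl
    rw [kreweras_rel] at *
    intro p q hpq
    have h1 := hij p q hpq
    have h2 := hkl p q hpq
    simp only [Fin.lt_def, Fin.le_def] at *
    by_cases a : (p : ℕ) ≤ i <;> by_cases b : (p : ℕ) ≤ k <;> by_cases c : (p : ℕ) ≤ j <;>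
      by_cases d : (p : ℕ) ≤ l <;> by_cases a' : (q : ℕ) ≤ i <;> by_cases b' : (q : ℕ) ≤ k <;>
      by_cases c' : (q : ℕ) ≤ j <;> by_cases d' : (q : ℕ) ≤ l <;>
      simp only [a, b, c, d, a', b', c', d', iff_true, iff_false, not_true] at h1 h2 ⊢ <;> omega
  refine ⟨⟨hK, ?_⟩, ?_⟩
  · rintro ⟨a, a'⟩ ⟨b, b'⟩ ⟨c, c'⟩ ⟨d, d'⟩ hab hbc hcd hac hbd
    change toLex (a, a') < toLex (b, b') at hab
    change toLex (b, b') < toLex (c, c') at hbc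
    change toLex (c, c') < toLex (d, d') at hcd
    rw [Prod.Lex.toLex_lt_toLex] at hab hbc hcd
    rcases hac with ⟨h1, h2, h3⟩ | ⟨h1, h2, h3⟩ <;> rcases hbd with ⟨g1, g2, g3⟩ | ⟨g1, g2, g3⟩ <;>
      change a' = _ at h1 <;> change c' = _ at h2 <;> change b' = _ at g1 <;>
      change d' = _ at g2 <;> subst h1 h2 g1 g2 <;>
      simp only [Fin.lt_def, Fin.ext_iff] at hab hbc hcd
    · refine Or.inl ⟨rfl, rfl, hπ a b c d ?_ ?_ ?_ h3 g3⟩ <;> simp_all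
    · exfalso
      have := (kreweras_rel π b d).1 g3 a c h3
      simp only [Fin.le_def] at this
      simp only [(by decide : ¬ (true < false)), and_false, or_false] at hab hbc hcd
      omega
    · exfalso
      have := (kreweras_rel π a c).1 h3 b d g3
      simp only [Fin.le_def] at this
      simp only [(by decide : ¬ (true < false)), and_false, or_false] at hab hbc hcd
      omega
    · refine Or.inr ⟨rfl, rfl, hK a b c d ?_ ?_ ?_ h3 g3⟩ <;> simp_all
  · rintro σ ⟨-, hσ⟩
    apply le_of_rel
    intro i j hij
    have key : ∀ i j : Fin n, σ.Rel i j → i < j → (kreweras π).Rel i j := by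
      intro i j hij hlt
      rw [kreweras_rel]
      have step : ∀ p q, π.Rel p q → i < p → p ≤ j → (i < q ∧ q ≤ j) := by
        intro p q hpq hip hpj
        by_contra hq
        rcases lt_or_ge i q with hiq | hqi
        · have hjq : j < q := by
            by_contra hh
            exact hq ⟨hiq, not_lt.1 hh⟩
          have := hσ (toLex (i, true)) (toLex (p, false)) (toLex (j, true)) (toLex (q, false))
            (by rw [Prod.Lex.toLex_lt_toLex]; exact Or.inl hip)
            (by
              rw [Prod.Lex.toLex_lt_toLex]
              rcases hpj.lt_or_eq with h | h
              · exact Or.inl h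
              · exact Or.inr ⟨h, Bool.false_lt_true⟩)
            (by rw [Prod.Lex.toLex_lt_toLex]; exact Or.inl hjq)
            (Or.inr ⟨rfl, rfl, hij⟩) (Or.inl ⟨rfl, rfl, hpq⟩)
          simp [doubledRel] at this
        · have := hσ (toLex (q, false)) (toLex (i, true)) (toLex (p, false)) (toLex (j, true))
            (by
              rw [Prod.Lex.toLex_lt_toLex]
              rcases hqi.lt_or_eq with h | h
              · exact Or.inl h
              · exact Or.inr ⟨h, Bool.false_lt_true⟩)
            (by rw [Prod.Lex.toLex_lt_toLex]; exact Or.inl hip)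
            (by
              rw [Prod.Lex.toLex_lt_toLex]
              rcases hpj.lt_or_eq with h | h
              · exact Or.inl h
              · exact Or.inr ⟨h, Bool.false_lt_true⟩)
            (Or.inl ⟨rfl, rfl, hpq.symm⟩) (Or.inr ⟨rfl, rfl, hij⟩)
          simp [doubledRel] at this
      intro p q hpq
      have h1 := step p q hpq
      have h2 := step q p hpq.symm
      simp only [Fin.lt_def, Fin.le_def] at *
      omega
    rcases lt_trichotomy i j with h | h | h
    · exact key i j hij h
    · subst h; exact Part.Rel.refl _ _
    · exact (key j i hij.symm h).symm

/-! ## Boxed convolution -/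

/-- Formal series `∑_w α_w z_w` in `s` non-commuting variables, given by their coefficients. -/
abbrev Series (s : ℕ) (R : Type*) : Type _ := List (Fin s) → R

/-- The restriction `w|V` of the word `w` to the set of positions `V`. -/
def restrict {s : ℕ} (w : List (Fin s)) (V : Finset (Fin w.length)) : List (Fin s) :=
  (V.sort (· ≤ ·)).map w.get

section

variable {s : ℕ} {R : Type*} [CommRing R]

/-- `X_{w,π}(f) = ∏_{V ∈ π} f_{w|V}`. -/
def coeffPart (f : Series s R) (w : List (Fin s)) (π : Part w.length) : R :=
  ∏ V ∈ π.parts, f (restrict w V)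

/-- The boxed convolution, an operation on series without constant term. -/
def box (f g : Series s R) : Series s R := fun w =>
  if w = [] then 0 else ∑ π ∈ NC w.length, coeffPart f w π * coeffPart g w (kreweras π)

/-- Truncation: forget all coefficients at words of length `> n`. -/
def trunc (n : ℕ) (f : Series s R) : Series s R := fun w => if w.length ≤ n then f w else 0

/-- The set `(𝔊ˢ)_n(R)` of all `∑_{1 ≤ |w| ≤ n} α_w z_w` with `α_1, …, α_s ∈ Rˣ`. -/
def G (s n : ℕ) (R : Type*) [CommRing R] : Set (Series s R) :=
  {f | f [] = 0 ∧ (∀ w, n < w.length → f w = 0) ∧ ∀ i, IsUnit (f [i])}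

/-- The set `(𝔊ˢ₊)_n(R)` of all `∑_{1 ≤ |w| ≤ n} α_w z_w` with `α_1 = ⋯ = α_s = 1`. -/
def GPlus (s n : ℕ) (R : Type*) [CommRing R] : Set (Series s R) :=
  {f | f [] = 0 ∧ (∀ w, n < w.length → f w = 0) ∧ ∀ i, f [i] = 1}

/-- The set `(𝔊ˢ₊)_{n,j}(R)` of those elements of `(𝔊ˢ₊)_n(R)` whose coefficients vanish for
`2 ≤ |w| ≤ j`. -/
def GPlusLevel (s n j : ℕ) (R : Type*) [CommRing R] : Set (Series s R) :=
  {f | f ∈ GPlus s n R ∧ ∀ w, 2 ≤ w.length → w.length ≤ j → f w = 0}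

theorem restrict_singleton (i : Fin s) (V : Finset (Fin [i].length)) (hV : V.Nonempty) :
    restrict [i] V = [i] := by
  have : V = {⟨0, by simp⟩} := by
    obtain ⟨x, hx⟩ := hV
    ext y
    have h1 : y = ⟨0, by simp⟩ := Fin.ext (by have := y.2; simp at this; simp)
    have h2 : x = ⟨0, by simp⟩ := Fin.ext (by have := x.2; simp at this; simp)
    subst h1; subst h2; simpa using hx
  subst this
  simp [restrict]

theorem coeffPart_singleton (f : Series s R) (i : Fin s) (π : Part [i].length) :
    coeffPart f [i] π = f [i] := by
  have hne : (Finset.univ : Finset (Fin [i].length)) ≠ ⊥ := by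
    intro h
    have : (⟨0, by simp⟩ : Fin [i].length) ∈ (⊥ : Finset (Fin [i].length)) := h ▸ Finset.mem_univ _
    simp at this
  have hcard : π.parts.card = 1 := by
    apply le_antisymm
    · simpa using π.card_parts_le_card
    · exact Finset.card_pos.2 (π.parts_nonempty hne)
  unfold coeffPart
  rw [Finset.prod_congr rfl (fun V hV => by
    rw [restrict_singleton i V (π.nonempty_of_mem_parts hV)]), Finset.prod_const, hcard, pow_one]

theorem NC_one : (NC 1).card = 1 := by decide

theorem box_singleton (f g : Series s R) (i : Fin s) : box f g [i] = f [i] * g [i] := by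
  have h : (NC [i].length).card = 1 := NC_one
  simp only [box, coeffPart_singleton, Finset.sum_const, h, one_smul]
  simp

/-- The multiplication of `(𝔊ˢ)_n(R)`: boxed convolution followed by truncation. -/
def mulG {n : ℕ} (f g : G s n R) : G s n R :=
  ⟨trunc n (box f.1 g.1), by simp [trunc, box], fun w hw => if_neg (not_le.2 hw), fun i => by
    by_cases hn : 1 ≤ n
    · simpa [trunc, hn, box_singleton] using (f.2.2.2 i).mul (g.2.2.2 i)
    · have h0 : f.1 [i] = 0 := f.2.2.1 [i] (by simpa using hn)
      have := f.2.2.2 i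
      rw [h0, isUnit_zero_iff] at this
      have : Subsingleton R := subsingleton_of_zero_eq_one this
      exact isUnit_of_subsingleton _⟩

/-- A ring homomorphism acts on `(𝔊ˢ)_n` coefficientwise. -/
def mapG {S : Type*} [CommRing S] {n : ℕ} (φ : R →+* S) (f : G s n R) : G s n S :=
  ⟨fun w => φ (f.1 w), by simp [f.2.1], fun w hw => by simp [f.2.2.1 w hw],
    fun i => (f.2.2.2 i).map φ⟩

theorem mapG_mulG {S : Type*} [CommRing S] {n : ℕ} (φ : R →+* S) (f g : G s n R) :
    mapG φ (mulG f g) = mulG (mapG φ f) (mapG φ g) := by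
  apply Subtype.ext
  funext w
  simp only [mapG, mulG, trunc, box, coeffPart]
  split_ifs <;> simp [map_sum, map_prod]

end

/-! ## Group functors -/

section

variable {k : Type u} [Field k]

variable (k) in
/-- Functors from commutative `k`-algebras to groups. -/
abbrev GroupFunctor : Type (u + 1) := CommAlgCat.{u} k ⥤ GrpCat.{u}

/-- `𝔾_a^d`, that is `R ↦ (R^d, +)`. -/
def additive (d : ℕ) : GroupFunctor k where
  obj R := GrpCat.of (Multiplicative (Fin d → R))
  map φ := GrpCat.ofHom (AddMonoidHom.toMultiplicative (φ.hom.toAddMonoidHom.compLeft (Fin d)))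

/-- `𝔾_a`, that is `R ↦ (R, +)`. -/
def Ga : GroupFunctor k where
  obj R := GrpCat.of (Multiplicative R)
  map φ := GrpCat.ofHom (AddMonoidHom.toMultiplicative φ.hom.toAddMonoidHom)

/-- `𝔾_m`, that is `R ↦ (Rˣ, ·)`. -/
def Gm : GroupFunctor k where
  obj R := GrpCat.of Rˣ
  map φ := GrpCat.ofHom (Units.map φ.hom.toMonoidHom)

/-- A group functor is an (affine) algebraic group if it is represented by a finitely generated
`k`-algebra. -/
def IsAlgebraicGroup (F : GroupFunctor k) : Prop :=
  ∃ A : CommAlgCat.{u} k, Algebra.FiniteType k A ∧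
    Nonempty (F ⋙ forget GrpCat.{u} ≅ coyoneda.obj (Opposite.op A))

/-- Subgroup functors of a group functor. -/
@[ext]
structure SubgroupFunctor (F : GroupFunctor k) where
  obj : ∀ R : CommAlgCat.{u} k, Subgroup (F.obj R)
  map_mem : ∀ {R S : CommAlgCat.{u} k} (φ : R ⟶ S) {g : F.obj R},
    g ∈ obj R → (F.map φ).hom g ∈ obj S

namespace SubgroupFunctor

variable {F : GroupFunctor k}

/-- The whole group. -/
def whole (F : GroupFunctor k) : SubgroupFunctor F where
  obj _ := ⊤
  map_mem _ _ _ := Subgroup.mem_top _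

/-- The trivial subgroup. -/
def trivial (F : GroupFunctor k) : SubgroupFunctor F where
  obj _ := ⊥
  map_mem _ g hg := by rw [Subgroup.mem_bot] at *; simp [hg]

/-- `H` is closed: membership of (images of) any point is the vanishing of an ideal. -/
def IsClosed (H : SubgroupFunctor F) : Prop :=
  ∀ (R : CommAlgCat.{u} k) (g : F.obj R), ∃ I : Ideal R, ∀ (S : CommAlgCat.{u} k) (φ : R ⟶ S),
    (F.map φ).hom g ∈ H.obj S ↔ ∀ a ∈ I, φ.hom a = 0

/-- `N` is a normal subgroup of `H`. -/
structure IsNormalIn (N H : SubgroupFunctor F) : Prop where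
  le : ∀ R, N.obj R ≤ H.obj R
  normal : ∀ R, ((N.obj R).subgroupOf (H.obj R)).Normal

/-- The map `H(R) → H(S)` induced by `R ⟶ S`. -/
def mapHom (H : SubgroupFunctor F) {R S : CommAlgCat.{u} k} (φ : R ⟶ S) :
    H.obj R →* H.obj S :=
  ((F.map φ).hom.comp (H.obj R).subtype).codRestrict (H.obj S) fun g => H.map_mem φ g.2

/-- The quotient group functor `R ↦ H(R) / N(R)`. -/
def quotient (H N : SubgroupFunctor F) (h : N.IsNormalIn H) : GroupFunctor k where
  obj R :=
    haveI := h.normal R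
    GrpCat.of (H.obj R ⧸ (N.obj R).subgroupOf (H.obj R))
  map {R S} φ :=
    haveI := h.normal R
    haveI := h.normal S
    GrpCat.ofHom (QuotientGroup.map _ _ (H.mapHom φ) fun _ hg => N.map_mem φ hg)
  map_id R := by
    refine ConcreteCategory.hom_ext _ _ fun x => ?_
    obtain ⟨x, rfl⟩ := QuotientGroup.mk_surjective x
    refine congrArg QuotientGroup.mk (Subtype.ext ?_)
    simp [mapHom]
  map_comp φ ψ := by
    refine ConcreteCategory.hom_ext _ _ fun x => ?_
    obtain ⟨x, rfl⟩ := QuotientGroup.mk_surjective x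
    refine congrArg QuotientGroup.mk (Subtype.ext ?_)
    simp [mapHom]

end SubgroupFunctor

/-- An algebraic group is split solvable if it has a finite subnormal series of closed subgroups
all of whose factor groups are isomorphic to `𝔾_a` or `𝔾_m`. -/
def IsSplitSolvable (F : GroupFunctor k) : Prop :=
  IsAlgebraicGroup F ∧ ∃ (m : ℕ) (H : ℕ → SubgroupFunctor F),
    H 0 = SubgroupFunctor.whole F ∧ H m = SubgroupFunctor.trivial F ∧
    ∀ i < m, (H (i + 1)).IsClosed ∧ ∃ h : (H (i + 1)).IsNormalIn (H i),
      Nonempty ((H i).quotient (H (i + 1)) h ≅ Ga) ∨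
      Nonempty ((H i).quotient (H (i + 1)) h ≅ Gm)

variable (k) in
/-- Group structures on all the sets `(𝔊ˢ)_n(R)` with the truncated boxed convolution as
multiplication (there is at most one). -/
structure GroupLaw (s n : ℕ) where
  group : ∀ R : CommAlgCat.{u} k, Group (G s n R)
  mul_eq : ∀ (R : CommAlgCat.{u} k) (f g : G s n R), (group R).mul f g = mulG f g

/-- The group functor `(𝔊ˢ)_n : R ↦ ((𝔊ˢ)_n(R), ⊠)`. -/
def GroupLaw.functor {s n : ℕ} (L : GroupLaw k s n) : GroupFunctor k where
  obj R :=
    letI := L.group R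
    GrpCat.of (G s n R)
  map {R S} φ :=
    letI := L.group R
    letI := L.group S
    GrpCat.ofHom (MonoidHom.mk' (mapG φ.hom.toRingHom) fun f g => by
      change mapG _ ((L.group R).mul f g) = (L.group S).mul _ _
      rw [L.mul_eq, L.mul_eq, mapG_mulG])

/-- An element of `(𝔊ˢ)_n(R)` as a point of the group functor. -/
def GroupLaw.point {s n : ℕ} (L : GroupLaw k s n) {R : CommAlgCat.{u} k} (f : G s n R) :
    L.functor.obj R := f

/-- The points of the subgroup functor `H` of `(𝔊ˢ)_n` are the elements of the sets `C R`. -/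
def GroupLaw.HasPoints {s n : ℕ} (L : GroupLaw k s n) (H : SubgroupFunctor L.functor)
    (C : ∀ R : CommAlgCat.{u} k, Set (Series s R)) : Prop :=
  ∀ (R : CommAlgCat.{u} k) (f : G s n R), L.point f ∈ H.obj R ↔ f.1 ∈ C R

end

end BoxedConvolution

open BoxedConvolution

namespace BoxedConvolution

/-! ## The lattice of non-crossing partitions -/

/-! The combinatorial core is associativity of ⊠. Write f_π for `coeffPart f w π`, and K_π(σ) for
the Kreweras complement of σ ≤ π taken inside each block of π (`relKreweras`). Multiplying out block
by block gives (f ⊠ g)_π = ∑_{σ ≤ π} f_σ g_{K_π(σ)} (`coeffPart_box`). So (f ⊠ g) ⊠ h has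
coefficient ∑_{σ ≤ π} f_σ g_{K_π(σ)} h_{K(π)}, and f ⊠ (g ⊠ h) has coefficient ∑_σ ∑_{τ ≤ K(σ)} f_σ
g_τ h_{K_{K(σ)}(τ)}. They agree because, for fixed σ, π ↦ K_π(σ) is a bijection from {π ≥ σ} onto {τ
≤ K(σ)} and K_{K(σ)}(K_π(σ)) = K(π) (`relKreweras_relKreweras`, `sum_relKreweras`). Bijectivity
rests on K being an order-reversing bijection of NC(n).

Everything else is triangularity in word length. The coefficient of f ⊠ g at w involves only
subwords of w, and f_w itself occurs only in the term π = ⊤, multiplied by the unit ∏ g_{w_i}. Hence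
left inverses are found recursively, and a left unit and left inverses suffice for a group. For the
same reason, if W is closed under subwords, the elements agreeing with the unit on W form a normal
subgroup (`agreeSubgroup`); all subgroups in the theorem have this form.

If f and g agree with the unit at all words shorter than w, only ⊥ and ⊤ contribute at w, so (f ⊠
g)_w = f_w + g_w when |w| ≥ 2; at a letter the coefficient is multiplicative. Enlarging W by all
words of length i + 2 yields the factor 𝔾_a^{s^{i+2}}. Enlarging it by one word at a time, shortest
first, yields factors 𝔾_m at letters and 𝔾_a at longer words. The coordinate ring is a polynomial
ring in the coefficients with those at letters inverted. -/

theorem Part.Rel.trans {n : ℕ} {π : Part n} {p q r : Fin n} (h : π.Rel p q) (h' : π.Rel q r) :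
    π.Rel p r := by
  obtain ⟨V, hV, hp, hq⟩ := h
  obtain ⟨W, hW, hq', hr⟩ := h'
  obtain rfl := π.eq_of_mem_parts hV hW hq hq'
  exact ⟨V, hV, hp, hr⟩

theorem Part.rel_of_mem {n : ℕ} {π : Part n} {p q : Fin n} {V : Finset (Fin n)}
    (hV : V ∈ π.parts) (hp : p ∈ V) (hq : q ∈ V) : π.Rel p q :=
  ⟨V, hV, hp, hq⟩

theorem Part.Rel.mem {n : ℕ} {π : Part n} {p q : Fin n} {V : Finset (Fin n)} (h : π.Rel p q)
    (hV : V ∈ π.parts) (hp : p ∈ V) : q ∈ V := by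
  obtain ⟨W, hW, hp', hq⟩ := h
  obtain rfl := π.eq_of_mem_parts hV hW hp hp'
  exact hq

theorem Part.exists_mem {n : ℕ} (π : Part n) (p : Fin n) : ∃ V ∈ π.parts, p ∈ V :=
  ⟨π.part p, π.part_mem.2 (Finset.mem_univ p), π.mem_part_self.2 (Finset.mem_univ p)⟩

theorem le_iff_rel {n : ℕ} {π σ : Part n} : π ≤ σ ↔ ∀ p q, π.Rel p q → σ.Rel p q := by
  refine ⟨fun h p q ⟨V, hV, hp, hq⟩ => ?_, le_of_rel⟩
  obtain ⟨W, hW, hVW⟩ := h hV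
  exact ⟨W, hW, hVW hp, hVW hq⟩

theorem Part.ext_rel {n : ℕ} {π σ : Part n} (h : ∀ p q, π.Rel p q ↔ σ.Rel p q) : π = σ :=
  le_antisymm (le_of_rel fun p q => (h p q).1) (le_of_rel fun p q => (h p q).2)

/-- The partition into the classes of an equivalence relation. -/
noncomputable def Part.ofSetoid {n : ℕ} (r : Setoid (Fin n)) : Part n :=
  haveI : DecidableRel r := Classical.decRel _
  Finpartition.ofSetoid r

theorem Part.ofSetoid_rel {n : ℕ} (r : Setoid (Fin n)) (p q : Fin n) :
    (Part.ofSetoid r).Rel p q ↔ r.r p q := by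
  rw [rel_iff_mem_part, Part.ofSetoid]
  let _ : DecidableRel r := Classical.decRel _
  refine (Finpartition.mem_part_ofSetoid_iff_rel (s := r)).trans ?_
  exact ⟨fun h => r.symm' h, fun h => r.symm' h⟩

theorem mem_NC {n : ℕ} {π : Part n} : π ∈ NC n ↔ π.NonCrossing := by
  simp [NC]

theorem kreweras_nonCrossing {n : ℕ} {π : Part n} (hπ : π.NonCrossing) :
    (kreweras π).NonCrossing :=
  (isGreatest_kreweras π hπ).1.1

/-! ### The Kreweras complement as an order-reversing bijection -/

theorem kreweras_anti {n : ℕ} {σ π : Part n} (h : σ ≤ π) : kreweras π ≤ kreweras σ := by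
  refine le_of_rel fun i j hij => ?_
  rw [kreweras_rel] at *
  exact fun p q hpq => hij p q (le_iff_rel.1 h p q hpq)

/-- It suffices to check one half of the invariance in the definition of the Kreweras
complement. -/
theorem kreweras_rel_of_imp {n : ℕ} {σ : Part n} {i j : Fin n} (hij : i ≤ j)
    (h : ∀ a b, σ.Rel a b → i < a → a ≤ j → i < b ∧ b ≤ j) : (kreweras σ).Rel i j := by
  rw [kreweras_rel]
  intro a b hab
  have h1 := h a b hab
  have h2 := h b a hab.symm
  simp only [Fin.lt_def, Fin.le_def] at *
  omega

/-- For consecutive elements i < v of a block, a block leaving the gap between them would cross the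
chord from i to v. So the gap is a union of blocks. -/
theorem kreweras_rel_pred {n : ℕ} {σ : Part n} (hσ : σ.NonCrossing) {i v : Fin n} (hiv : i < v)
    (hr : σ.Rel i v) (hgap : ∀ x, i < x → x < v → ¬ σ.Rel i x) :
    (kreweras σ).Rel i ⟨v - 1, by omega⟩ := by
  refine kreweras_rel_of_imp (by simp only [Fin.lt_def, Fin.le_def] at *; omega) ?_
  intro a b hab hia hav
  have hav : a < v := by simp only [Fin.lt_def, Fin.le_def] at *; omega
  have hna := hgap a hia hav
  rcases lt_trichotomy b i with hb | rfl | hb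
  · exact absurd (hσ b i a v hb hia hav hab.symm hr) hna
  · exact absurd hab.symm hna
  refine ⟨hb, ?_⟩
  rcases lt_trichotomy b v with hb' | rfl | hb'
  · simp only [Fin.lt_def, Fin.le_def] at *; omega
  · exact absurd (hr.trans hab.symm) hna
  · exact absurd (hr.trans (hσ i a v b hia hav hb' hr hab).symm) hna

/-- The hypothesis `H` says that no block of K(σ) crosses a chord from p to q. If p ≁ q, let i be
the last element before q of the block of p. The block of K(σ) containing i also contains the barred
point just before the cyclic successor of i in its block, and that point lies outside [p, q). -/
theorem rel_of_kreweras {n : ℕ} {σ : Part n} (hσ : σ.NonCrossing) {p q : Fin n} (hpq : p < q)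
    (H : ∀ i j, (kreweras σ).Rel i j → p ≤ i → i < q → p ≤ j ∧ j < q) : σ.Rel p q := by
  by_contra hn
  obtain ⟨i, hi⟩ := (Finset.univ.filter fun x => σ.Rel p x ∧ x < q).exists_maximal
    ⟨p, by simp [hpq, Part.Rel.refl]⟩
  have hi' : σ.Rel p i ∧ i < q := by simpa using hi.1
  have himax : ∀ x, σ.Rel p x → x < q → x ≤ i := fun x hx hxq => by
    by_contra hix
    exact hix (hi.2 (by simp [hx, hxq]) (le_of_not_ge hix))
  have hpi : p ≤ i := himax p (Part.Rel.refl _ _) hpq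
  by_cases hv : ∃ v, σ.Rel p v ∧ q < v
  · obtain ⟨v, hv⟩ := (Finset.univ.filter fun x => σ.Rel p x ∧ q < x).exists_minimal
      (by obtain ⟨v, hv⟩ := hv; exact ⟨v, by simpa using hv⟩)
    have hv' : σ.Rel p v ∧ q < v := by simpa using hv.1
    have hvmin : ∀ x, σ.Rel p x → q < x → v ≤ x := fun x hx hxq => by
      by_contra hix
      exact hix (hv.2 (by simp [hx, hxq]) (le_of_not_ge hix))
    have := H i _ (kreweras_rel_pred hσ (hi'.2.trans hv'.2) (hi'.1.symm.trans hv'.1) ?_) hpi hi'.2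
    · have h1 := hv'.2
      simp only [Fin.lt_def, Fin.le_def] at *
      omega
    · intro x hix hxv hx
      have hx := hi'.1.trans hx
      rcases lt_trichotomy x q with h | rfl | h
      · exact absurd (himax x hx h) (not_le.2 hix)
      · exact hn hx
      · exact absurd (hvmin x hx h) (not_le.2 hxv)
  · have hmax : ∀ x, σ.Rel p x → x ≤ i := by
      intro x hx
      rcases lt_trichotomy x q with h | rfl | h
      · exact himax x hx h
      · exact absurd hx hn
      · exact absurd ⟨x, hx, h⟩ hv
    obtain ⟨m, hm⟩ := (Finset.univ.filter fun x => σ.Rel p x).exists_minimal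
      ⟨p, by simp [Part.Rel.refl]⟩
    have hm' : σ.Rel p m := by simpa using hm.1
    have hmmin : ∀ x, σ.Rel p x → m ≤ x := fun x hx => by
      by_contra hix
      exact hix (hm.2 (by simp [hx]) (le_of_not_ge hix))
    have key : ∀ a b, σ.Rel a b → m ≤ a → a ≤ i → m ≤ b ∧ b ≤ i := by
      intro a b hab hma hai
      by_cases ha : σ.Rel p a
      · exact ⟨hmmin b (ha.trans hab), hmax b (ha.trans hab)⟩
      have hma : m < a := lt_of_le_of_ne hma (by rintro rfl; exact ha hm')
      have hai : a < i := lt_of_le_of_ne hai (by rintro rfl; exact ha hi'.1)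
      by_contra hb
      rcases lt_or_ge b m with h | h
      · exact ha (hm'.trans (hσ b m a i h hma hai hab.symm (hm'.symm.trans hi'.1)))
      · have h : i < b := by by_contra hh; exact hb ⟨h, not_lt.1 hh⟩
        exact ha (hi'.1.trans (hσ m a i b hma hai h (hm'.symm.trans hi'.1) hab).symm)
    have hmp := hmmin p (Part.Rel.refl _ _)
    have hiq := hi'.2
    -- Here i is the maximum and m the minimum of the block, so the cyclic successor of i is m. The
    -- predecessor of m is n - 1 when m = 0.
    by_cases h0 : (m : ℕ) = 0
    · have hr : (kreweras σ).Rel i ⟨n - 1, by omega⟩ := by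
        refine kreweras_rel_of_imp (by simp only [Fin.le_def]; omega) ?_
        intro a b hab hia _
        have := key b a hab.symm
        simp only [Fin.lt_def, Fin.le_def] at *
        omega
      have := H _ _ hr hpi hiq
      simp only [Fin.lt_def, Fin.le_def] at *
      omega
    · have hr : (kreweras σ).Rel ⟨m - 1, by omega⟩ i := by
        refine kreweras_rel_of_imp (by simp only [Fin.le_def] at *; omega) ?_
        intro a b hab hia _
        have := key a b hab
        simp only [Fin.lt_def, Fin.le_def] at *
        omega
      have := H _ _ hr.symm hpi hiq
      simp only [Fin.lt_def, Fin.le_def] at *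
      omega

/-- No block of K(σ) crosses a chord of σ, so no block of the finer K(π) does; by `rel_of_kreweras`
the ends of the chord are related in π. -/
theorem le_of_kreweras_le {n : ℕ} {σ π : Part n} (hπ : π.NonCrossing)
    (h : kreweras π ≤ kreweras σ) : σ ≤ π := by
  have key : ∀ p q, σ.Rel p q → p < q → π.Rel p q := by
    intro p q hpq hlt
    refine rel_of_kreweras hπ hlt fun i j hij hpi hiq => ?_
    have := (kreweras_rel σ i j).1 (le_iff_rel.1 h i j hij) p q hpq
    simp only [Fin.lt_def, Fin.le_def] at *
    omega
  refine le_of_rel fun p q hpq => ?_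
  rcases lt_trichotomy p q with h | rfl | h
  · exact key p q hpq h
  · exact Part.Rel.refl _ _
  · exact (key q p hpq.symm h).symm

theorem kreweras_injOn {n : ℕ} {σ π : Part n} (hσ : σ.NonCrossing) (hπ : π.NonCrossing)
    (h : kreweras σ = kreweras π) : σ = π :=
  le_antisymm (le_of_kreweras_le hπ h.ge) (le_of_kreweras_le hσ h.le)

theorem exists_kreweras_eq {n : ℕ} {ρ : Part n} (hρ : ρ.NonCrossing) :
    ∃ π : Part n, π.NonCrossing ∧ kreweras π = ρ := by
  have := Finset.surjOn_of_injOn_of_card_le (s := NC n) (t := NC n) kreweras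
    (fun π hπ => by
      rw [Finset.mem_coe, mem_NC] at *
      exact kreweras_nonCrossing hπ)
    (fun σ hσ π hπ h => kreweras_injOn (mem_NC.1 hσ) (mem_NC.1 hπ) h) le_rfl
  obtain ⟨π, hπ, h⟩ := this (mem_NC.2 hρ)
  exact ⟨π, mem_NC.1 hπ, h⟩

/-! ### The relative Kreweras complement -/

/-- The Kreweras complement of `σ` inside each block of `π`. -/
noncomputable def relKreweras {n : ℕ} (π σ : Part n) : Part n :=
  Part.ofSetoid
    { r := fun i j => π.Rel i j ∧
        ∀ p q : Fin n, σ.Rel p q → π.Rel p i → π.Rel q i → ((p ≤ i ↔ p ≤ j) ↔ (q ≤ i ↔ q ≤ j))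
      iseqv :=
        { refl := fun i => ⟨Part.Rel.refl _ _, fun p q _ _ _ => by simp⟩
          symm := fun {i j} h => ⟨h.1.symm, fun p q hpq hp hq => by
            have := h.2 p q hpq (hp.trans h.1.symm) (hq.trans h.1.symm)
            tauto⟩
          trans := fun {i j l} h h' => ⟨h.1.trans h'.1, fun p q hpq hp hq => by
            have h1 := h.2 p q hpq hp hq
            have h2 := h'.2 p q hpq (hp.trans h.1) (hq.trans h.1)
            tauto⟩ } }

theorem relKreweras_rel {n : ℕ} (π σ : Part n) (i j : Fin n) :
    (relKreweras π σ).Rel i j ↔ π.Rel i j ∧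
      ∀ p q : Fin n, σ.Rel p q → π.Rel p i → π.Rel q i →
        ((p ≤ i ↔ p ≤ j) ↔ (q ≤ i ↔ q ≤ j)) :=
  Part.ofSetoid_rel _ _ _

theorem relKreweras_nonCrossing {n : ℕ} {π σ : Part n} (hπ : π.NonCrossing) :
    (relKreweras π σ).NonCrossing := by
  intro i k j l hik hkj hjl hij hkl
  rw [relKreweras_rel] at *
  have hkj' := hπ i k j l hik hkj hjl hij.1 hkl.1
  refine ⟨hkj', fun p q hpq hp hq => ?_⟩
  have h1 := hij.2 p q hpq (hp.trans (hkj'.trans hij.1.symm)) (hq.trans (hkj'.trans hij.1.symm))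
  have h2 := hkl.2 p q hpq hp hq
  simp only [Fin.lt_def, Fin.le_def] at *
  -- (k, j] is the intersection of (i, j] and (k, l], and `h1`, `h2` say that p and q are on the
  -- same side of both; the cases check this.
  by_cases a : (p : ℕ) ≤ i <;> by_cases b : (p : ℕ) ≤ k <;> by_cases c : (p : ℕ) ≤ j <;>
    by_cases d : (p : ℕ) ≤ l <;> by_cases a' : (q : ℕ) ≤ i <;> by_cases b' : (q : ℕ) ≤ k <;>
    by_cases c' : (q : ℕ) ≤ j <;> by_cases d' : (q : ℕ) ≤ l <;>
    simp only [a, b, c, d, a', b', c', d', iff_true, iff_false, not_true] at h1 h2 ⊢ <;> omega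

theorem relKreweras_le {n : ℕ} {π σ : Part n} : relKreweras π σ ≤ π :=
  le_of_rel fun i j h => ((relKreweras_rel π σ i j).1 h).1

/-- A block of σ inside the π-block of i respects (i, j] by the definition of `relKreweras`. Any
other block of σ respects it because π is non-crossing and already joins i to j. -/
theorem relKreweras_le_kreweras {n : ℕ} {π σ : Part n} (hπ : π.NonCrossing) (h : σ ≤ π) :
    relKreweras π σ ≤ kreweras σ := by
  have key : ∀ i j, (relKreweras π σ).Rel i j → i < j → (kreweras σ).Rel i j := by
    intro i j hij hlt
    rw [relKreweras_rel] at hij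
    refine kreweras_rel_of_imp hlt.le fun a b hab hia haj => ?_
    have hab' := le_iff_rel.1 h a b hab
    by_cases ha : π.Rel a i
    · have := hij.2 a b hab ha (hab'.symm.trans ha)
      simp only [Fin.lt_def, Fin.le_def] at *
      omega
    · have haj : a < j :=
        lt_of_le_of_ne haj (by rintro rfl; exact ha hij.1.symm)
      by_contra hb
      rcases lt_trichotomy b i with hb' | rfl | hb'
      · exact ha (hπ b i a j hb' hia haj hab'.symm hij.1).symm
      · exact ha hab'
      · have hjb : j < b := by
          by_contra hh
          rcases (not_lt.1 hh).lt_or_eq with hh | rfl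
          · exact hb ⟨hb', hh.le⟩
          · exact ha (hab'.trans hij.1.symm)
        exact ha ((hπ i a j b hia haj hjb hij.1 hab').trans hij.1.symm)
  refine le_of_rel fun p q hpq => ?_
  rcases lt_trichotomy p q with h | rfl | h
  · exact key p q hpq h
  · exact Part.Rel.refl _ _
  · exact (key q p hpq.symm h).symm

theorem kreweras_le_relKreweras {n : ℕ} {π σ : Part n} (h : σ ≤ π) :
    kreweras π ≤ relKreweras (kreweras σ) (relKreweras π σ) := by
  refine le_of_rel fun i j hij => (relKreweras_rel _ _ _ _).2
    ⟨le_iff_rel.1 (kreweras_anti h) i j hij, fun p q hpq _ _ => ?_⟩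
  exact (kreweras_rel π i j).1 hij p q (le_iff_rel.1 relKreweras_le p q hpq)

/-- For the hard inclusion, suppose i and j are related on the left but some π-block, that of a, has
elements both inside and outside (i, j]. The proof finds p inside and p' outside, in that block,
which are related in `relKreweras π σ` and lie in the K(σ)-block of i. This contradicts the relation
of i and j on the left. -/
theorem relKreweras_relKreweras {n : ℕ} {π σ : Part n} (hπ : π.NonCrossing) (hσ : σ.NonCrossing)
    (h : σ ≤ π) : relKreweras (kreweras σ) (relKreweras π σ) = kreweras π := by
  refine le_antisymm ?_ (kreweras_le_relKreweras h)
  have key : ∀ i j, (relKreweras (kreweras σ) (relKreweras π σ)).Rel i j → i < j →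
      (kreweras π).Rel i j := by
    intro i j hij hlt
    rw [relKreweras_rel] at hij
    obtain ⟨hij, hτ⟩ := hij
    have hσij := (kreweras_rel σ i j).1 hij
    refine kreweras_rel_of_imp hlt.le fun a b hab hia haj => ?_
    by_contra hb
    obtain ⟨p, hp⟩ := (Finset.univ.filter fun x => π.Rel a x ∧ i < x ∧ x ≤ j).exists_maximal
      ⟨a, by simp [hia, haj, Part.Rel.refl]⟩
    have hp' : π.Rel a p ∧ i < p ∧ p ≤ j := by simpa using hp.1
    have hpmax : ∀ x, π.Rel a x → i < x → x ≤ j → x ≤ p := fun x hx h1 h2 => by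
      by_contra hix
      exact hix (hp.2 (by simp [hx, h1, h2]) (le_of_not_ge hix))
    -- p' is the last element of the π-block that is ≤ i or, failing that, the last element of the
    -- whole block. In the first case the elements of the block in (p', p] are those in (i, j]; in
    -- the second those in (p, p'] are those outside. As i and j are related in K(σ), σ respects
    -- this division.
    obtain ⟨p', hap', hp'ij, hτpp'⟩ : ∃ p', π.Rel a p' ∧ ¬ (i < p' ∧ p' ≤ j) ∧
        (relKreweras π σ).Rel p p' := by
      by_cases hlow : ∃ x, π.Rel a x ∧ x ≤ i
      · obtain ⟨p', hm⟩ := (Finset.univ.filter fun x => π.Rel a x ∧ x ≤ i).exists_maximal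
          (by obtain ⟨x, hx⟩ := hlow; exact ⟨x, by simpa using hx⟩)
        have hm' : π.Rel a p' ∧ p' ≤ i := by simpa using hm.1
        have hmax : ∀ x, π.Rel a x → x ≤ i → x ≤ p' := fun x hx h1 => by
          by_contra hix
          exact hix (hm.2 (by simp [hx, h1]) (le_of_not_ge hix))
        refine ⟨p', hm'.1, fun hh => absurd hh.1 (not_lt.2 hm'.2), ?_⟩
        rw [relKreweras_rel]
        refine ⟨hp'.1.symm.trans hm'.1, fun x y hxy hx hy => ?_⟩
        have hx := hp'.1.trans hx.symm
        have hy := hp'.1.trans hy.symm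
        have h1 := hσij x y hxy
        have h2 := hpmax x hx
        have h3 := hpmax y hy
        have h4 := hmax x hx
        have h5 := hmax y hy
        have h6 := hm'.2
        have h7 := hp'.2
        simp only [Fin.lt_def, Fin.le_def] at *
        omega
      · obtain ⟨p', hm⟩ := (Finset.univ.filter fun x => π.Rel a x).exists_maximal
          ⟨a, by simp [Part.Rel.refl]⟩
        have hm' : π.Rel a p' := by simpa using hm.1
        have hmax : ∀ x, π.Rel a x → x ≤ p' := fun x hx => by
          by_contra hix
          exact hix (hm.2 (by simp [hx]) (le_of_not_ge hix))
        have hlow : ∀ x, π.Rel a x → i < x := fun x hx => by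
          by_contra hh
          exact hlow ⟨x, hx, not_lt.1 hh⟩
        have hb1 := hlow b hab
        have hb2 := hmax b hab
        refine ⟨p', hm', ?_, ?_⟩
        · simp only [Fin.lt_def, Fin.le_def] at *
          omega
        rw [relKreweras_rel]
        refine ⟨hp'.1.symm.trans hm', fun x y hxy hx hy => ?_⟩
        have hx := hp'.1.trans hx.symm
        have hy := hp'.1.trans hy.symm
        have h1 := hσij x y hxy
        have h2 := hpmax x hx
        have h3 := hpmax y hy
        have h4 := hmax x hx
        have h5 := hmax y hy
        have h6 := hlow x hx
        have h7 := hlow y hy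
        have h8 := hp'.2
        simp only [Fin.lt_def, Fin.le_def] at *
        omega
    have hK := le_iff_rel.1 (relKreweras_le_kreweras hπ h) _ _ hτpp'
    -- The chords from p to p' and from i to j, both in K(σ), either cross or share an end, so they
    -- lie in one block.
    have hip : (kreweras σ).Rel i p := by
      rcases hp'.2.2.lt_or_eq with hpj | rfl
      · rcases lt_trichotomy p' i with h1 | rfl | h1
        · exact kreweras_nonCrossing hσ p' i p j h1 hp'.2.1 hpj hK.symm hij
        · exact hK.symm
        · have hjp' : j < p' := by
            by_contra hh
            exact hp'ij ⟨h1, not_lt.1 hh⟩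
          exact hij.trans (kreweras_nonCrossing hσ i p j p' hp'.2.1 hpj hjp' hij hK).symm
      · exact hij
    have := hτ p p' hτpp' hip.symm (hip.trans hK).symm
    have h8 := hp'.2
    simp only [Fin.lt_def, Fin.le_def] at *
    omega
  refine le_of_rel fun p q hpq => ?_
  rcases lt_trichotomy p q with h | rfl | h
  · exact key p q hpq h
  · exact Part.Rel.refl _ _
  · exact (key q p hpq.symm h).symm

open Classical in
/-- Reindexing pairs `σ ≤ π` by the relative Kreweras complement of `σ` in `π`. -/
theorem sum_relKreweras {n : ℕ} {M : Type*} [AddCommMonoid M] {σ : Part n} (hσ : σ.NonCrossing)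
    (F : Part n → Part n → M) :
    ∑ π ∈ (NC n).filter (σ ≤ ·), F (relKreweras π σ) (kreweras π) =
      ∑ τ ∈ (NC n).filter (· ≤ kreweras σ), F τ (relKreweras (kreweras σ) τ) := by
  have hmaps : ∀ π ∈ (NC n).filter (σ ≤ ·),
      relKreweras π σ ∈ (NC n).filter (· ≤ kreweras σ) := by
    intro π hπ
    rw [Finset.mem_filter, mem_NC] at *
    exact ⟨relKreweras_nonCrossing hπ.1, relKreweras_le_kreweras hπ.1 hπ.2⟩
  -- K_π(σ) and σ determine K(π), hence π.
  have hinj : Set.InjOn (relKreweras · σ) ((NC n).filter (σ ≤ ·) : Finset (Part n)) := by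
    intro π hπ π' hπ' he
    rw [Finset.mem_coe, Finset.mem_filter, mem_NC] at hπ hπ'
    refine kreweras_injOn hπ.1 hπ'.1 ?_
    rw [← relKreweras_relKreweras hπ.1 hσ hπ.2, ← relKreweras_relKreweras hπ'.1 hσ hπ'.2]
    exact congrArg _ he
  refine Finset.sum_nbij (relKreweras · σ) hmaps hinj
    (Finset.surjOn_of_injOn_of_card_le _ hmaps hinj ?_) fun π hπ => ?_
  -- Surjectivity by counting: K maps {π ≥ σ} onto {ρ ≤ K(σ)}, so the target is no larger than the
  -- source.
  · have : (NC n).filter (· ≤ kreweras σ) ⊆ ((NC n).filter (σ ≤ ·)).image kreweras := by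
      intro ρ hρ
      rw [Finset.mem_filter, mem_NC] at hρ
      obtain ⟨π, hπ, rfl⟩ := exists_kreweras_eq hρ.1
      exact Finset.mem_image.2 ⟨π, by
        rw [Finset.mem_filter, mem_NC]; exact ⟨hπ, le_of_kreweras_le hπ hρ.2⟩, rfl⟩
    exact (Finset.card_le_card this).trans Finset.card_image_le
  · rw [Finset.mem_filter, mem_NC] at hπ
    rw [relKreweras_relKreweras hπ.1 hσ hπ.2]

/-! ## Associativity of the boxed convolution -/

section

variable {s : ℕ} {R : Type*} [CommRing R]

/-! ### Subwords and refinement block by block -/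

theorem length_restrict (w : List (Fin s)) (V : Finset (Fin w.length)) :
    (restrict w V).length = V.card := by
  simp [restrict]

theorem restrict_ne_nil {w : List (Fin s)} {V : Finset (Fin w.length)} (hV : V.Nonempty) :
    restrict w V ≠ [] := by
  rw [← List.length_pos_iff_ne_nil, length_restrict]
  exact hV.card_pos

/-- The position in `w` of a letter of `w|V`. -/
def pos (w : List (Fin s)) (V : Finset (Fin w.length)) :
    Fin (restrict w V).length ↪o Fin w.length :=
  V.orderEmbOfFin (length_restrict w V).symm

theorem pos_mem (w : List (Fin s)) (V : Finset (Fin w.length)) (a) : pos w V a ∈ V :=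
  Finset.orderEmbOfFin_mem _ _ _

theorem exists_pos_eq {w : List (Fin s)} {V : Finset (Fin w.length)} {i : Fin w.length}
    (hi : i ∈ V) : ∃ a, pos w V a = i := by
  have : i ∈ Set.range (V.orderEmbOfFin (length_restrict w V).symm) := by
    rw [Finset.range_orderEmbOfFin]; exact hi
  exact this

theorem get_pos (w : List (Fin s)) (V : Finset (Fin w.length)) (a) :
    w.get (pos w V a) = (restrict w V).get a := by
  have h : (a : ℕ) < (V.sort (· ≤ ·)).length := by
    simpa [restrict] using a.2
  have h1 : pos w V a = (V.sort (· ≤ ·))[(a : ℕ)] := Finset.orderEmbOfFin_apply _ _ _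
  rw [h1]
  change _ = ((V.sort (· ≤ ·)).map w.get)[(a : ℕ)]'(by simpa using h)
  rw [List.getElem_map]

theorem restrict_restrict (w : List (Fin s)) (V : Finset (Fin w.length))
    (B : Finset (Fin (restrict w V).length)) :
    restrict (restrict w V) B = restrict w (B.map (pos w V).toEmbedding) := by
  have h : (B.map (pos w V).toEmbedding).sort (· ≤ ·) = (B.sort (· ≤ ·)).map (pos w V) :=
    (((pos w V).strictMono.strictMonoOn _).map_finsetSort (f := (pos w V).toEmbedding)).symm
  calc (B.sort (· ≤ ·)).map (restrict w V).get
      = (B.sort (· ≤ ·)).map (w.get ∘ pos w V) :=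
        List.map_congr_left fun a _ => (get_pos w V a).symm
    _ = ((B.map (pos w V).toEmbedding).sort (· ≤ ·)).map w.get := by rw [h, List.map_map]

/-- The partition of the positions of `w|V` induced by a partition of the positions of `w`. -/
noncomputable def restrictPart (w : List (Fin s)) (V : Finset (Fin w.length)) (σ : Part w.length) :
    Part (restrict w V).length :=
  Part.ofSetoid
    { r := fun a b => σ.Rel (pos w V a) (pos w V b)
      iseqv := ⟨fun _ => Part.Rel.refl _ _, fun h => h.symm, fun h h' => h.trans h'⟩ }

theorem restrictPart_rel (w : List (Fin s)) (V : Finset (Fin w.length)) (σ : Part w.length) (a b) :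
    (restrictPart w V σ).Rel a b ↔ σ.Rel (pos w V a) (pos w V b) :=
  Part.ofSetoid_rel _ _ _

theorem restrictPart_nonCrossing (w : List (Fin s)) (V : Finset (Fin w.length))
    {σ : Part w.length} (hσ : σ.NonCrossing) : (restrictPart w V σ).NonCrossing := by
  intro a b c d hab hbc hcd hac hbd
  rw [restrictPart_rel] at *
  exact hσ _ _ _ _ ((pos w V).strictMono hab) ((pos w V).strictMono hbc)
    ((pos w V).strictMono hcd) hac hbd

/-- `relKreweras` tests only points in the π-block of i, and `pos` is an order isomorphism onto that
block; so on each block it is the ordinary complement. -/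
theorem kreweras_restrictPart_rel {w : List (Fin s)} {π σ : Part w.length}
    {V : Finset (Fin w.length)} (hV : V ∈ π.parts) (a b) :
    (kreweras (restrictPart w V σ)).Rel a b ↔
      (relKreweras π σ).Rel (pos w V a) (pos w V b) := by
  rw [kreweras_rel, relKreweras_rel]
  constructor
  · refine fun H => ⟨Part.rel_of_mem hV (pos_mem _ _ _) (pos_mem _ _ _), fun p q hpq hp hq => ?_⟩
    obtain ⟨p, rfl⟩ := exists_pos_eq (hp.symm.mem hV (pos_mem _ _ _))
    obtain ⟨q, rfl⟩ := exists_pos_eq (hq.symm.mem hV (pos_mem _ _ _))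
    simpa using H p q ((restrictPart_rel _ _ _ _ _).2 hpq)
  · intro H p q hpq
    have hm : ∀ x, π.Rel (pos w V x) (pos w V a) := fun x =>
      Part.rel_of_mem hV (pos_mem _ _ _) (pos_mem _ _ _)
    simpa using H.2 _ _ ((restrictPart_rel _ _ _ _ _).1 hpq) (hm p) (hm q)

/-- Stated for any ρ that corresponds to τ on V, so as to cover both `restrictPart` of σ (with τ =
σ) and its Kreweras complement (with τ = `relKreweras π σ`). -/
theorem map_part {w : List (Fin s)} {π τ : Part w.length} (h : τ ≤ π)
    {V : Finset (Fin w.length)} (hV : V ∈ π.parts) {ρ : Part (restrict w V).length}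
    (hρ : ∀ a b, ρ.Rel a b ↔ τ.Rel (pos w V a) (pos w V b)) (a) :
    (ρ.part a).map (pos w V).toEmbedding = τ.part (pos w V a) := by
  ext y
  rw [← rel_iff_mem_part, Finset.mem_map]
  constructor
  · rintro ⟨b, hb, rfl⟩
    rw [← rel_iff_mem_part] at hb
    exact (hρ b a).1 hb
  · intro hy
    obtain ⟨b, rfl⟩ := exists_pos_eq
      ((le_iff_rel.1 h _ _ hy).symm.mem hV (pos_mem w V a))
    exact ⟨b, (rel_iff_mem_part _ _ _).1 ((hρ b a).2 hy), rfl⟩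

/-- The coefficient at a refinement of `π` is a product over the blocks of `π`. -/
theorem coeffPart_eq_prod (f : Series s R) {w : List (Fin s)} {π τ : Part w.length} (h : τ ≤ π)
    (ρ : ∀ V ∈ π.parts, Part (restrict w V).length)
    (hρ : ∀ V hV a b, (ρ V hV).Rel a b ↔ τ.Rel (pos w V a) (pos w V b)) :
    coeffPart f w τ = ∏ x ∈ π.parts.attach, coeffPart f (restrict w x.1) (ρ x.1 x.2) := by
  unfold coeffPart
  rw [Finset.prod_sigma']
  symm
  refine Finset.prod_bij (fun x _ => x.2.map (pos w x.1.1).toEmbedding) ?_ ?_ ?_ ?_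
  · rintro ⟨⟨V, hV⟩, B⟩ hB
    have hB : B ∈ (ρ V hV).parts := by simpa using hB
    obtain ⟨a, ha⟩ := (ρ V hV).nonempty_of_mem_parts hB
    rw [← (ρ V hV).part_eq_of_mem hB ha]
    simp only [map_part h hV (hρ V hV) a]
    exact τ.part_mem.2 (Finset.mem_univ _)
  · rintro ⟨⟨V, hV⟩, B⟩ hB ⟨⟨V', hV'⟩, B'⟩ hB' he
    have hB : B ∈ (ρ V hV).parts := by simpa using hB
    obtain ⟨a, ha⟩ := (ρ V hV).nonempty_of_mem_parts hB
    have h1 : pos w V a ∈ B.map (pos w V).toEmbedding := Finset.mem_map_of_mem _ ha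
    have h2 : pos w V a ∈ B'.map (pos w V').toEmbedding := by
      simp only at he; rw [← he]; exact h1
    obtain ⟨a', _, ha'⟩ := Finset.mem_map.1 h2
    obtain rfl := π.eq_of_mem_parts hV hV' (pos_mem w V a) (ha' ▸ pos_mem w V' a')
    obtain rfl := Finset.map_injective _ he
    rfl
  · intro C hC
    obtain ⟨c, hc⟩ := τ.nonempty_of_mem_parts hC
    obtain ⟨V, hV, hcV⟩ := π.exists_mem c
    obtain ⟨a, rfl⟩ := exists_pos_eq hcV
    refine ⟨⟨⟨V, hV⟩, (ρ V hV).part a⟩, ?_, ?_⟩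
    · simp
    · simp only [map_part h hV (hρ V hV) a]
      exact τ.part_eq_of_mem hC hc
  · rintro ⟨⟨V, hV⟩, B⟩ _
    exact congrArg f (restrict_restrict w V B)

/-- Gluing partitions of the blocks of `π`. -/
theorem exists_restrictPart_eq {w : List (Fin s)} {π : Part w.length} (hπ : π.NonCrossing)
    (p : ∀ V ∈ π.parts, Part (restrict w V).length) (hp : ∀ V hV, (p V hV).NonCrossing) :
    ∃ σ : Part w.length, σ.NonCrossing ∧ σ ≤ π ∧ ∀ V hV, restrictPart w V σ = p V hV := by
  let r : Setoid (Fin w.length) :=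
    { r := fun i j => ∃ V, ∃ hV : V ∈ π.parts, ∃ a b, pos w V a = i ∧ pos w V b = j ∧
        (p V hV).Rel a b
      iseqv :=
        { refl := fun i => by
            obtain ⟨V, hV, hi⟩ := π.exists_mem i
            obtain ⟨a, rfl⟩ := exists_pos_eq hi
            exact ⟨V, hV, a, a, rfl, rfl, Part.Rel.refl _ _⟩
          symm := by
            rintro _ _ ⟨V, hV, a, b, rfl, rfl, h⟩
            exact ⟨V, hV, b, a, rfl, rfl, h.symm⟩
          trans := by
            rintro _ _ _ ⟨V, hV, a, b, rfl, rfl, h⟩ ⟨V', hV', b', c, hb, rfl, h'⟩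
            obtain rfl := π.eq_of_mem_parts hV hV' (pos_mem w V b) (hb ▸ pos_mem w V' b')
            obtain rfl := (pos w V).injective hb
            exact ⟨V, hV, a, c, rfl, rfl, h.trans h'⟩ } }
  have hle : ∀ i j, (Part.ofSetoid r).Rel i j → π.Rel i j := by
    intro i j hij
    obtain ⟨V, hV, a, b, rfl, rfl, -⟩ := (Part.ofSetoid_rel _ _ _).1 hij
    exact Part.rel_of_mem hV (pos_mem _ _ _) (pos_mem _ _ _)
  refine ⟨Part.ofSetoid r, ?_, le_of_rel hle, fun V hV => Part.ext_rel fun a b => ?_⟩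
  · intro i k j l hik hkj hjl hij hkl
    -- Since π is non-crossing, all four points lie in one block V, where the crossing is excluded
    -- by `hp V`.
    have hkj' := hπ i k j l hik hkj hjl (hle _ _ hij) (hle _ _ hkl)
    rw [Part.ofSetoid_rel] at *
    obtain ⟨V, hV, a, b, rfl, rfl, h⟩ := hij
    obtain ⟨V', hV', c, d, rfl, rfl, h'⟩ := hkl
    obtain rfl := π.eq_of_mem_parts hV hV' (hkj'.symm.mem hV (pos_mem _ _ _)) (pos_mem _ _ _)
    refine ⟨V, hV, c, b, rfl, rfl, hp V hV a c b d ((pos w V).lt_iff_lt.1 hik)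
      ((pos w V).lt_iff_lt.1 hkj) ((pos w V).lt_iff_lt.1 hjl) h h'⟩
  · rw [restrictPart_rel, Part.ofSetoid_rel]
    constructor
    · rintro ⟨V', hV', a', b', ha, hb, h⟩
      obtain rfl := π.eq_of_mem_parts hV hV' (pos_mem w V a) (ha ▸ pos_mem w V' a')
      obtain rfl := (pos w V).injective ha
      obtain rfl := (pos w V).injective hb
      exact h
    · exact fun h => ⟨V, hV, a, b, rfl, rfl, h⟩

theorem eq_of_restrictPart_eq {w : List (Fin s)} {π σ σ' : Part w.length} (h : σ ≤ π) (h' : σ' ≤ π)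
    (he : ∀ V ∈ π.parts, restrictPart w V σ = restrictPart w V σ') : σ = σ' := by
  have key : ∀ {σ σ' : Part w.length}, σ ≤ π →
      (∀ V ∈ π.parts, restrictPart w V σ = restrictPart w V σ') → σ ≤ σ' := by
    intro σ σ' h he
    refine le_of_rel fun i j hij => ?_
    obtain ⟨V, hV, hi, hj⟩ := le_iff_rel.1 h i j hij
    obtain ⟨a, rfl⟩ := exists_pos_eq hi
    obtain ⟨b, rfl⟩ := exists_pos_eq hj
    rw [← restrictPart_rel] at *
    rwa [← he V hV]
  exact le_antisymm (key h he) (key h' fun V hV => (he V hV).symm)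

theorem box_apply (f g : Series s R) {w : List (Fin s)} (hw : w ≠ []) :
    box f g w = ∑ π ∈ NC w.length, coeffPart f w π * coeffPart g w (kreweras π) :=
  if_neg hw

-- Expanding the product over the blocks of π of sums over NC gives a sum over families of
-- non-crossing partitions of the blocks; gluing identifies such families with the non-crossing σ ≤
-- π.
open Classical in
theorem coeffPart_box (f g : Series s R) {w : List (Fin s)} {π : Part w.length}
    (hπ : π.NonCrossing) :
    coeffPart (box f g) w π =
      ∑ σ ∈ (NC w.length).filter (· ≤ π), coeffPart f w σ * coeffPart g w (relKreweras π σ) := by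
  have h1 : coeffPart (box f g) w π = ∏ V ∈ π.parts, ∑ ρ ∈ NC (restrict w V).length,
      coeffPart f (restrict w V) ρ * coeffPart g (restrict w V) (kreweras ρ) :=
    Finset.prod_congr rfl fun V hV =>
      box_apply f g (restrict_ne_nil (π.nonempty_of_mem_parts hV))
  rw [h1, Finset.prod_sum]
  symm
  refine Finset.sum_bij (fun σ _ V _ => restrictPart w V σ) ?_ ?_ ?_ ?_
  · intro σ hσ
    rw [Finset.mem_filter, mem_NC] at hσ
    exact Finset.mem_pi.2 fun V hV => mem_NC.2 (restrictPart_nonCrossing w V hσ.1)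
  · intro σ hσ σ' hσ' he
    rw [Finset.mem_filter] at hσ hσ'
    exact eq_of_restrictPart_eq hσ.2 hσ'.2 fun V hV => congrFun (congrFun he V) hV
  · intro p hp
    rw [Finset.mem_pi] at hp
    obtain ⟨σ, hσ, hle, he⟩ := exists_restrictPart_eq hπ p fun V hV => mem_NC.1 (hp V hV)
    exact ⟨σ, by rw [Finset.mem_filter, mem_NC]; exact ⟨hσ, hle⟩,
      funext fun V => funext fun hV => he V hV⟩
  · intro σ hσ
    rw [Finset.mem_filter] at hσ
    rw [Finset.prod_mul_distrib,
      coeffPart_eq_prod f hσ.2 (fun V _ => restrictPart w V σ) fun V _ => restrictPart_rel w V σ,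
      coeffPart_eq_prod g relKreweras_le (fun V _ => kreweras (restrictPart w V σ)) fun V hV =>
        kreweras_restrictPart_rel hV]

theorem box_assoc (f g h : Series s R) : box (box f g) h = box f (box g h) := by
  classical
  funext w
  by_cases hw : w = []
  · simp [box, hw]
  rw [box_apply _ _ hw, box_apply _ _ hw]
  calc ∑ π ∈ NC w.length, coeffPart (box f g) w π * coeffPart h w (kreweras π)
      = ∑ π ∈ NC w.length, ∑ σ ∈ (NC w.length).filter (· ≤ π), coeffPart f w σ *
          (coeffPart g w (relKreweras π σ) * coeffPart h w (kreweras π)) :=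
        Finset.sum_congr rfl fun π hπ => by
          rw [coeffPart_box f g (mem_NC.1 hπ), Finset.sum_mul]
          exact Finset.sum_congr rfl fun _ _ => mul_assoc _ _ _
    _ = ∑ σ ∈ NC w.length, ∑ π ∈ (NC w.length).filter (σ ≤ ·), coeffPart f w σ *
          (coeffPart g w (relKreweras π σ) * coeffPart h w (kreweras π)) :=
        Finset.sum_comm' fun π σ => by simp only [Finset.mem_filter]; tauto
    -- For fixed σ, the substitution τ = K_π(σ) turns the inner sum into the expansion of g ⊠ h at
    -- K(σ).
    _ = ∑ σ ∈ NC w.length, coeffPart f w σ * coeffPart (box g h) w (kreweras σ) :=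
        Finset.sum_congr rfl fun σ hσ => by
          rw [sum_relKreweras (mem_NC.1 hσ) fun τ ρ =>
              coeffPart f w σ * (coeffPart g w τ * coeffPart h w ρ),
            coeffPart_box g h (kreweras_nonCrossing (mem_NC.1 hσ)), Finset.mul_sum]

end

/-! ## The groups `(𝔊ˢ)_n(R)` -/

theorem bot_rel {n : ℕ} (p q : Fin n) : (⊥ : Part n).Rel p q ↔ p = q := by
  constructor
  · rintro ⟨V, hV, hp, hq⟩
    obtain ⟨a, -, rfl⟩ := Finpartition.mem_bot_iff.1 hV
    rw [Finset.mem_singleton] at hp hq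
    rw [hp, hq]
  · rintro rfl
    exact Part.Rel.refl _ _

theorem top_rel {n : ℕ} (p q : Fin n) : (⊤ : Part n).Rel p q := by
  obtain ⟨V, hV, hp⟩ := Part.exists_mem ⊤ p
  have := Finpartition.parts_top_subset _ hV
  rw [Finset.mem_singleton] at this
  exact ⟨V, hV, hp, by rw [this]; exact Finset.mem_univ q⟩

theorem bot_mem_NC (n : ℕ) : (⊥ : Part n) ∈ NC n := by
  refine mem_NC.2 fun p q p' q' h1 h2 _ h _ => ?_
  rw [bot_rel] at h
  exact absurd (h1.trans h2) (by simp [h])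

theorem top_mem_NC (n : ℕ) : (⊤ : Part n) ∈ NC n :=
  mem_NC.2 fun _ _ _ _ _ _ _ _ _ => top_rel _ _

theorem kreweras_bot (n : ℕ) : kreweras (⊥ : Part n) = ⊤ := by
  refine Part.ext_rel fun i j => iff_of_true ?_ (top_rel i j)
  rw [kreweras_rel]
  intro p q h
  rw [bot_rel] at h
  rw [h]

theorem kreweras_top (n : ℕ) : kreweras (⊤ : Part n) = ⊥ := by
  refine Part.ext_rel fun i j => ?_
  rw [kreweras_rel, bot_rel]
  constructor
  · intro h
    have := h i j (top_rel i j)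
    simp only [Fin.le_def, Fin.ext_iff] at *
    omega
  · rintro rfl
    simp

theorem card_lt_of_ne_top {n : ℕ} {π : Part n} (h : π ≠ ⊤) {V : Finset (Fin n)}
    (hV : V ∈ π.parts) : V.card < n := by
  refine lt_of_le_of_ne (by simpa using V.card_le_univ) fun hc => h ?_
  have hu : V = Finset.univ := Finset.eq_univ_of_card V (by simpa using hc)
  exact Part.ext_rel fun p q =>
    iff_of_true (Part.rel_of_mem hV (by simp [hu]) (by simp [hu])) (top_rel p q)

theorem exists_one_lt_card {n : ℕ} {π : Part n} (h : π ≠ ⊥) : ∃ V ∈ π.parts, 1 < V.card := by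
  by_contra! hc
  refine h (Part.ext_rel fun p q => ?_)
  rw [bot_rel]
  constructor
  · rintro ⟨V, hV, hp, hq⟩
    exact Finset.card_le_one.1 (hc V hV) p hp q hq
  · rintro rfl
    exact Part.Rel.refl _ _

theorem parts_top_eq {n : ℕ} [NeZero n] : (⊤ : Part n).parts = {Finset.univ} := by
  ext V
  rw [Finset.mem_singleton]
  have h : ∀ V ∈ (⊤ : Part n).parts, V = Finset.univ := fun V hV => by
    simpa using Finpartition.parts_top_subset _ hV
  refine ⟨h V, ?_⟩
  rintro rfl
  obtain ⟨V, hV, -⟩ := Part.exists_mem (⊤ : Part n) 0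
  exact h V hV ▸ hV

section

variable {s : ℕ} {R : Type*} [CommRing R]

/-! ### Extreme terms of the convolution, the unit and left inverses -/

theorem restrict_univ (w : List (Fin s)) : restrict w Finset.univ = w := by
  have h : (Finset.univ : Finset (Fin w.length)).sort (· ≤ ·) = List.finRange w.length :=
    Fin.sort_univ _
  rw [restrict, h, ← List.ofFn_eq_map]
  exact List.ofFn_get w

theorem coeffPart_top (f : Series s R) {w : List (Fin s)} (hw : w ≠ []) :
    coeffPart f w ⊤ = f w := by
  have : NeZero w.length := ⟨by simpa using hw⟩
  rw [coeffPart, parts_top_eq, Finset.prod_singleton, restrict_univ]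

theorem coeffPart_bot (f : Series s R) (w : List (Fin s)) :
    coeffPart f w ⊥ = ∏ i : Fin w.length, f [w.get i] := by
  rw [coeffPart, Finpartition.parts_bot, Finset.prod_map]
  exact Finset.prod_congr rfl fun i _ => by simp [restrict]

theorem coeffPart_congr {f f' : Series s R} {w : List (Fin s)} {π : Part w.length}
    (h : ∀ V ∈ π.parts, f (restrict w V) = f' (restrict w V)) :
    coeffPart f w π = coeffPart f' w π :=
  Finset.prod_congr rfl h

theorem box_congr {f f' g g' : Series s R} {w : List (Fin s)}
    (hf : ∀ V : Finset (Fin w.length), V.Nonempty → f (restrict w V) = f' (restrict w V))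
    (hg : ∀ V : Finset (Fin w.length), V.Nonempty → g (restrict w V) = g' (restrict w V)) :
    box f g w = box f' g' w := by
  by_cases hw : w = []
  · simp [box, hw]
  rw [box_apply _ _ hw, box_apply _ _ hw]
  exact Finset.sum_congr rfl fun π _ => congrArg₂ _
    (coeffPart_congr fun V hV => hf V (π.nonempty_of_mem_parts hV))
    (coeffPart_congr fun V hV => hg V ((kreweras π).nonempty_of_mem_parts hV))

/-- The remaining sum involves f only at words shorter than w, which makes the equation f ⊠ g = 1
triangular in f. -/
theorem box_eq_top_add (f g : Series s R) {w : List (Fin s)} (hw : w ≠ []) :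
    box f g w = f w * coeffPart g w ⊥ +
      ∑ π ∈ (NC w.length).erase ⊤, coeffPart f w π * coeffPart g w (kreweras π) := by
  rw [box_apply _ _ hw, ← Finset.add_sum_erase _ _ (top_mem_NC _), coeffPart_top f hw,
    kreweras_top]

/-- The unit series `∑_i z_i`. -/
def unitSeries (s : ℕ) (R : Type*) [CommRing R] : Series s R :=
  fun w => if w.length = 1 then 1 else 0

theorem unitSeries_singleton (i : Fin s) : unitSeries s R [i] = 1 := rfl

theorem unitSeries_of_length_ne {w : List (Fin s)} (h : w.length ≠ 1) : unitSeries s R w = 0 :=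
  if_neg h

theorem coeffPart_unitSeries_bot (w : List (Fin s)) : coeffPart (unitSeries s R) w ⊥ = 1 := by
  rw [coeffPart_bot]
  exact Finset.prod_eq_one fun _ _ => rfl

/-- If `f` vanishes at the words `w|V` with `2 ≤ |V| < |w|`, only `⊥` and `⊤` contribute. -/
theorem coeffPart_eq_zero {f : Series s R} {w : List (Fin s)}
    (h : ∀ u, 2 ≤ u.length → u.length < w.length → f u = 0) {π : Part w.length} (hb : π ≠ ⊥)
    (ht : π ≠ ⊤) : coeffPart f w π = 0 := by
  obtain ⟨V, hV, hc⟩ := exists_one_lt_card hb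
  exact Finset.prod_eq_zero hV
    (h _ (by rw [length_restrict]; exact hc) (by rw [length_restrict]; exact card_lt_of_ne_top ht hV))

theorem box_eq_add_of_vanish {f g : Series s R} {w : List (Fin s)} (hw : 2 ≤ w.length)
    (h : ∀ u, 2 ≤ u.length → u.length < w.length → f u = 0) :
    box f g w = f w * coeffPart g w ⊥ + coeffPart f w ⊥ * g w := by
  have hw0 : w ≠ [] := by rintro rfl; simp at hw
  have hne : (⊥ : Part w.length) ≠ ⊤ := by
    intro he
    have := (bot_rel (⟨0, by omega⟩ : Fin w.length) ⟨1, by omega⟩).1 (he ▸ top_rel _ _)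
    simp at this
  rw [box_eq_top_add _ _ hw0, Finset.sum_eq_single ⊥, kreweras_bot, coeffPart_top g hw0]
  · intro π hπ hb
    rw [coeffPart_eq_zero h hb (Finset.ne_of_mem_erase hπ), zero_mul]
  · intro hn
    exact absurd (Finset.mem_erase.2 ⟨hne, bot_mem_NC _⟩) hn

theorem unitSeries_box (g : Series s R) (hg : g [] = 0) : box (unitSeries s R) g = g := by
  funext w
  rcases Nat.lt_or_ge w.length 2 with h | h
  · match w, h with
    | [], _ => simp [box, hg]
    | [i], _ => rw [box_singleton, unitSeries_singleton, one_mul]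
  · rw [box_eq_add_of_vanish h fun u hu _ => unitSeries_of_length_ne (by omega),
      coeffPart_unitSeries_bot, unitSeries_of_length_ne (by omega)]
    simp

theorem exists_box_eq_unitSeries {g : Series s R} (hg : ∀ i, IsUnit (g [i])) (n : ℕ) :
    ∃ f : Series s R, f [] = 0 ∧ (∀ w, n < w.length → f w = 0) ∧
      ∀ w, w.length ≤ n → box f g w = unitSeries s R w := by
  induction n with
  | zero =>
    refine ⟨0, rfl, fun _ _ => rfl, fun w hw => ?_⟩
    obtain rfl : w = [] := by simpa using hw
    simp [box, unitSeries]
  | succ n ih =>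
    obtain ⟨f, hf0, hfn, hf⟩ := ih
    -- The value in length n + 1 solves `box_eq_top_add` for the top coefficient; `Ring.inverse` is
    -- a true inverse here, since `coeffPart g w ⊥` is a product of units.
    let f' : Series s R := fun w => if w.length = n + 1 then
      Ring.inverse (coeffPart g w ⊥) * (unitSeries s R w -
        ∑ π ∈ (NC w.length).erase ⊤, coeffPart f w π * coeffPart g w (kreweras π)) else f w
    have hff' : ∀ u : List (Fin s), u.length ≠ n + 1 → f' u = f u := fun u hu => if_neg hu
    refine ⟨f', by simp [f', hf0], fun w hw => ?_, fun w hw => ?_⟩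
    · rw [hff' w (by omega), hfn w (by omega)]
    rcases Nat.lt_or_ge n w.length with h | h
    · have hw : w.length = n + 1 := by omega
      have hw0 : w ≠ [] := by rintro rfl; simp at hw
      have hu : IsUnit (coeffPart g w ⊥) := by
        rw [coeffPart_bot]
        exact IsUnit.prod_univ_iff.2 fun i => hg _
      rw [box_eq_top_add _ _ hw0]
      have h1 : ∑ π ∈ (NC w.length).erase ⊤, coeffPart f' w π * coeffPart g w (kreweras π) =
          ∑ π ∈ (NC w.length).erase ⊤, coeffPart f w π * coeffPart g w (kreweras π) :=
        Finset.sum_congr rfl fun π hπ => by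
          rw [coeffPart_congr fun V hV => hff' _ ?_]
          have := card_lt_of_ne_top (Finset.ne_of_mem_erase hπ) hV
          rw [length_restrict]
          omega
      rw [h1, show f' w = _ from if_pos hw, mul_right_comm, Ring.inverse_mul_cancel _ hu, one_mul,
        sub_add_cancel]
    · rw [← hf w h]
      refine box_congr (fun V _ => hff' _ ?_) fun _ _ => rfl
      have : V.card ≤ w.length := by simpa using V.card_le_univ
      rw [length_restrict]
      omega

theorem length_restrict_le (w : List (Fin s)) (V : Finset (Fin w.length)) :
    (restrict w V).length ≤ w.length := by
  rw [length_restrict]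
  simpa using V.card_le_univ

theorem trunc_apply {n : ℕ} (f : Series s R) {w : List (Fin s)} (hw : w.length ≤ n) :
    trunc n f w = f w :=
  if_pos hw

/-- Subwords of a word of length ≤ n have length ≤ n, so truncating the factors first changes
nothing; this carries associativity over to `mulG`. -/
theorem trunc_box_congr {n : ℕ} {f f' g g' : Series s R}
    (hf : ∀ w, w.length ≤ n → f w = f' w) (hg : ∀ w, w.length ≤ n → g w = g' w) :
    trunc n (box f g) = trunc n (box f' g') := by
  funext w
  unfold trunc
  split_ifs with hw
  · exact box_congr (fun V _ => hf _ ((length_restrict_le w V).trans hw))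
      fun V _ => hg _ ((length_restrict_le w V).trans hw)
  · rfl

theorem trunc_coe {n : ℕ} (f : G s n R) : trunc n f.1 = f.1 := by
  funext w
  unfold trunc
  split_ifs with hw
  · rfl
  · exact (f.2.2.1 w (not_le.1 hw)).symm

theorem mulG_assoc {n : ℕ} (f g h : G s n R) : mulG (mulG f g) h = mulG f (mulG g h) := by
  apply Subtype.ext
  change trunc n (box (trunc n (box f.1 g.1)) h.1) = trunc n (box f.1 (trunc n (box g.1 h.1)))
  rw [trunc_box_congr (fun w hw => trunc_apply (box f.1 g.1) hw) fun _ _ => rfl, box_assoc]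
  exact trunc_box_congr (fun _ _ => rfl) fun w hw => (trunc_apply _ hw).symm

/-- The unit element. -/
def oneG (s n : ℕ) (R : Type*) [CommRing R] : G s (n + 1) R :=
  ⟨unitSeries s R, rfl, fun w hw => unitSeries_of_length_ne (by omega),
    fun _ => isUnit_one⟩

theorem oneG_mulG {n : ℕ} (f : G s (n + 1) R) : mulG (oneG s n R) f = f := by
  apply Subtype.ext
  change trunc _ (box (unitSeries s R) f.1) = f.1
  rw [unitSeries_box _ f.2.1, trunc_coe]

theorem exists_mulG_eq_oneG {n : ℕ} (g : G s (n + 1) R) :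
    ∃ f : G s (n + 1) R, mulG f g = oneG s n R := by
  obtain ⟨f, hf0, hfn, hf⟩ := exists_box_eq_unitSeries g.2.2.2 (n + 1)
  refine ⟨⟨f, hf0, hfn, fun i => ?_⟩, ?_⟩
  · have := hf [i] (by simp)
    rw [box_singleton] at this
    exact IsUnit.of_mul_eq_one _ this
  · apply Subtype.ext
    funext w
    change trunc _ (box f g.1) w = unitSeries s R w
    unfold trunc
    split_ifs with hw
    · exact hf w hw
    · exact (unitSeries_of_length_ne (by omega)).symm

noncomputable instance instGroupG (n : ℕ) : Group (G s (n + 1) R) :=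
  letI : Mul (G s (n + 1) R) := ⟨mulG⟩
  letI : One (G s (n + 1) R) := ⟨oneG s n R⟩
  letI : Inv (G s (n + 1) R) := ⟨fun g => (exists_mulG_eq_oneG g).choose⟩
  Group.ofLeftAxioms mulG_assoc oneG_mulG fun g => (exists_mulG_eq_oneG g).choose_spec

theorem coe_mul {n : ℕ} (f g : G s (n + 1) R) : (f * g).1 = trunc (n + 1) (box f.1 g.1) := rfl

/-! ### Subgroups defined by prescribing coefficients -/

/-- Sets of words that are closed under passing to subwords. -/
def SubwordClosed (W : Set (List (Fin s))) : Prop :=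
  ∀ w ∈ W, ∀ V : Finset (Fin w.length), V.Nonempty → restrict w V ∈ W

/-- Restriction of coefficients to W is thus compatible with products. The elements agreeing with
the unit on W then behave like the kernel of a homomorphism, without constructing its target. -/
theorem mul_apply_congr {n : ℕ} {W : Set (List (Fin s))} (hW : SubwordClosed W)
    {f f' g g' : G s (n + 1) R} (hf : ∀ w ∈ W, f.1 w = f'.1 w) (hg : ∀ w ∈ W, g.1 w = g'.1 w) :
    ∀ w ∈ W, (f * g).1 w = (f' * g').1 w := by
  intro w hw
  rw [coe_mul, coe_mul]
  unfold trunc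
  split_ifs
  · exact box_congr (fun V hV => hf _ (hW w hw V hV)) fun V hV => hg _ (hW w hw V hV)
  · rfl

/-- The subgroup of all elements which agree with the unit on `W`. -/
def agreeSubgroup (n : ℕ) (R : Type*) [CommRing R] {W : Set (List (Fin s))}
    (hW : SubwordClosed W) : Subgroup (G s (n + 1) R) where
  carrier := {f | ∀ w ∈ W, f.1 w = (1 : G s (n + 1) R).1 w}
  one_mem' := fun _ _ => rfl
  mul_mem' := fun {f g} hf hg w hw => by
    rw [mul_apply_congr hW hf hg w hw, one_mul]
  inv_mem' := fun {f} hf w hw => by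
    -- On W, f * f⁻¹ agrees with 1 * f⁻¹.
    have := mul_apply_congr hW hf (fun _ _ => rfl : ∀ w ∈ W, (f⁻¹).1 w = (f⁻¹).1 w) w hw
    rwa [mul_inv_cancel, one_mul, eq_comm] at this

theorem mem_agreeSubgroup {n : ℕ} {W : Set (List (Fin s))} {hW : SubwordClosed W}
    {f : G s (n + 1) R} : f ∈ agreeSubgroup n R hW ↔ ∀ w ∈ W, f.1 w = unitSeries s R w :=
  Iff.rfl

instance agreeSubgroup_normal {n : ℕ} {W : Set (List (Fin s))} (hW : SubwordClosed W) :
    (agreeSubgroup n R hW).Normal where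
  conj_mem f hf g w hw := by
    -- On W, g * f agrees with g, so g * f * g⁻¹ agrees with the unit.
    have h1 := mul_apply_congr hW (fun _ _ => rfl : ∀ w ∈ W, g.1 w = g.1 w) hf
    rw [mul_one] at h1
    rw [mul_apply_congr hW h1 (fun _ _ => rfl : ∀ w ∈ W, (g⁻¹).1 w = (g⁻¹).1 w) w hw,
      mul_inv_cancel]

end

/-! ## The group functor `(𝔊ˢ)_n` and its subgroup functors -/

section

variable {k : Type u} [Field k]

/-- A natural surjective homomorphism `H(R) → T(R)` with kernel `N(R)` identifies the quotient
functor with `T`. -/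
theorem SubgroupFunctor.quotient_iso {F : GroupFunctor k} {H N : SubgroupFunctor F}
    (h : N.IsNormalIn H) (T : GroupFunctor k) (c : ∀ R, H.obj R →* T.obj R)
    (hnat : ∀ {R S : CommAlgCat.{u} k} (φ : R ⟶ S) (x : H.obj R),
      c S (H.mapHom φ x) = (T.map φ).hom (c R x))
    (hker : ∀ R (x : H.obj R), c R x = 1 ↔ x.1 ∈ N.obj R)
    (hsurj : ∀ R, Function.Surjective (c R)) : Nonempty (H.quotient N h ≅ T) := by
  have hN := h.normal
  have hle : ∀ R, (N.obj R).subgroupOf (H.obj R) ≤ (c R).ker := fun R x hx =>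
    (c R).mem_ker.2 ((hker R x).2 hx)
  have hbij : ∀ R, Function.Bijective (QuotientGroup.lift _ (c R) (hle R)) := by
    intro R
    constructor
    · rw [injective_iff_map_eq_one]
      intro x hx
      obtain ⟨x, rfl⟩ := QuotientGroup.mk_surjective x
      rw [QuotientGroup.lift_mk] at hx
      exact (QuotientGroup.eq_one_iff x).2 ((hker R x).1 hx)
    · intro y
      obtain ⟨x, rfl⟩ := hsurj R y
      exact ⟨x, rfl⟩
  refine ⟨NatIso.ofComponents
    (fun R => MulEquiv.toGrpIso (X := (H.quotient N h).obj R) (Y := T.obj R)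
      (MulEquiv.ofBijective (QuotientGroup.lift _ (c R) (hle R)) (hbij R))) ?_⟩
  intro _ _ φ
  refine ConcreteCategory.hom_ext _ _ fun x => ?_
  obtain ⟨x, rfl⟩ := QuotientGroup.mk_surjective x
  exact hnat φ x

variable (k) in
/-- The group law of `(𝔊ˢ)_{n+1}`. -/
noncomputable def groupLaw (s n : ℕ) : GroupLaw k s (n + 1) where
  group _ := instGroupG n
  mul_eq _ _ _ := rfl

variable {s n : ℕ}

theorem map_unitSeries {R S : Type*} [CommRing R] [CommRing S] (φ : R →+* S)
    (w : List (Fin s)) : φ (unitSeries s R w) = unitSeries s S w := by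
  unfold unitSeries
  split_ifs <;> simp

variable (k n) in
/-- The subgroup functor of all elements which agree with the unit on `W`. -/
noncomputable def agree {W : Set (List (Fin s))} (hW : SubwordClosed W) :
    SubgroupFunctor (groupLaw k s n).functor where
  obj R := agreeSubgroup n R hW
  map_mem {R S} φ g hg := fun w hw => by
    change φ.hom (Subtype.val (p := fun f => f ∈ G s (n + 1) R) g w) = unitSeries s S w
    rw [hg w hw]
    exact map_unitSeries φ.hom.toRingHom w

theorem mem_agree {W : Set (List (Fin s))} {hW : SubwordClosed W} {R : CommAlgCat.{u} k}
    {f : G s (n + 1) R} : (groupLaw k s n).point f ∈ (agree k n hW).obj R ↔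
      ∀ w ∈ W, f.1 w = unitSeries s R w :=
  Iff.rfl

theorem agree_isNormalIn {W W' : Set (List (Fin s))} (hW : SubwordClosed W)
    (hW' : SubwordClosed W') (h : W ⊆ W') :
    (agree k n hW').IsNormalIn (agree k n hW) where
  le _ _ hf w hw := hf w (h hw)
  normal _ := (agreeSubgroup_normal hW').subgroupOf _

theorem agree_isClosed {W : Set (List (Fin s))} (hW : SubwordClosed W) :
    (agree k n hW).IsClosed := by
  intro R (g : G s (n + 1) R)
  refine ⟨Ideal.span {a | ∃ w ∈ W, a = g.1 w - unitSeries s R w}, fun S φ => ?_⟩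
  have hle : (∀ a ∈ Ideal.span {a | ∃ w ∈ W, a = g.1 w - unitSeries s R w}, φ.hom a = 0) ↔
      ∀ w ∈ W, φ.hom (g.1 w - unitSeries s R w) = 0 := by
    constructor
    · exact fun h w hw => h _ (Ideal.subset_span ⟨w, hw, rfl⟩)
    · intro h
      change Ideal.span _ ≤ RingHom.ker φ.hom
      rw [Ideal.span_le]
      rintro _ ⟨w, hw, rfl⟩
      exact h w hw
  rw [hle]
  refine forall₂_congr fun w _ => ?_
  rw [map_sub, sub_eq_zero]
  have := map_unitSeries (s := s) φ.hom.toRingHom w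
  change _ = unitSeries s S w ↔ _ = φ.hom.toRingHom _
  rw [this]
  rfl

theorem agree_eq_trivial {W : Set (List (Fin s))} (hW : SubwordClosed W)
    (h : ∀ w, w.length ≤ n + 1 → w ∈ W) :
    agree k n hW = SubgroupFunctor.trivial (groupLaw k s n).functor := by
  ext R (f : G s (n + 1) R)
  refine Iff.trans ?_ (Subgroup.mem_bot (x := f)).symm
  constructor
  · intro hf
    apply Subtype.ext
    funext w
    by_cases hw : w.length ≤ n + 1
    · exact hf w (h w hw)
    · rw [f.2.2.1 w (not_le.1 hw), (1 : G s (n + 1) R).2.2.1 w (not_le.1 hw)]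
  · rintro rfl w _
    rfl

/-- Sets of words that contain all words shorter than one of their elements. -/
def LengthClosed (W : Set (List (Fin s))) : Prop :=
  ∀ w ∈ W, ∀ u : List (Fin s), u.length < w.length → u ∈ W

/-- A proper subword is shorter. Length-closed sets are convenient because a shortest missing word
can be adjoined without losing the property. -/
theorem LengthClosed.subwordClosed {W : Set (List (Fin s))} (hW : LengthClosed W) :
    SubwordClosed W := by
  intro w hw V _
  rcases (length_restrict_le w V).lt_or_eq with h | h
  · exact hW w hw _ h
  · have : V = Finset.univ := Finset.eq_univ_of_card V (by
      rw [← length_restrict, h, Fintype.card_fin])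
    rwa [this, restrict_univ]

theorem LengthClosed.insert {W : Set (List (Fin s))} (hW : LengthClosed W) {w : List (Fin s)}
    (hw : ∀ u : List (Fin s), u.length < w.length → u ∈ W) : LengthClosed (insert w W) := by
  rintro v (rfl | hv) u hu
  · exact Or.inr (hw u hu)
  · exact Or.inr (hW v hv u hu)

theorem lengthClosed_length_le (s j : ℕ) : LengthClosed {w : List (Fin s) | w.length ≤ j} :=
  fun _ hw _ hu => hu.le.trans hw

/-! ### Coefficients as homomorphisms -/

theorem mul_apply_singleton {R : Type*} [CommRing R] (f g : G s (n + 1) R) (i : Fin s) :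
    (f * g).1 [i] = f.1 [i] * g.1 [i] := by
  rw [coe_mul, trunc_apply _ (by simp), box_singleton]

/-- Coefficients are additive at words whose shorter words carry the coefficients of the unit. -/
theorem mul_apply_of_agree {R : Type*} [CommRing R] {f g : G s (n + 1) R} {w : List (Fin s)}
    (h2 : 2 ≤ w.length) (hn : w.length ≤ n + 1)
    (hf : ∀ u : List (Fin s), u.length < w.length → f.1 u = unitSeries s R u)
    (hg : ∀ u : List (Fin s), u.length < w.length → g.1 u = unitSeries s R u) :
    (f * g).1 w = f.1 w + g.1 w := by
  have hb : ∀ f : Series s R, (∀ u : List (Fin s), u.length < w.length → f u = unitSeries s R u) →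
      coeffPart f w ⊥ = 1 := fun f hf => by
    rw [coeffPart_bot]
    exact Finset.prod_eq_one fun i _ => hf _ h2
  rw [coe_mul, trunc_apply _ hn, box_eq_add_of_vanish h2 fun u hu hu' => by
    rw [hf u hu', unitSeries_of_length_ne (by omega)], hb _ hf, hb _ hg, mul_one, one_mul]

/-- The unit with some coefficients at words of length `2 ≤ |w| ≤ n + 1` added. -/
def addCoeff {R : Type*} [CommRing R] (a : List (Fin s) → R) : G s (n + 1) R :=
  ⟨fun w => unitSeries s R w + if 2 ≤ w.length ∧ w.length ≤ n + 1 then a w else 0,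
    by simp [unitSeries],
    fun w hw => by
      dsimp only
      rw [unitSeries_of_length_ne (by omega), if_neg (by omega), add_zero],
    fun i => by simp [unitSeries]⟩

theorem addCoeff_apply {R : Type*} [CommRing R] (a : List (Fin s) → R) {w : List (Fin s)}
    (h2 : 2 ≤ w.length) (hn : w.length ≤ n + 1) :
    (addCoeff a : G s (n + 1) R).1 w = a w := by
  change unitSeries s R w + ite _ _ _ = _
  rw [unitSeries_of_length_ne (by omega), if_pos ⟨h2, hn⟩, zero_add]

theorem addCoeff_apply_of_eq_zero {R : Type*} [CommRing R] {a : List (Fin s) → R}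
    {w : List (Fin s)} (h : a w = 0) :
    (addCoeff a : G s (n + 1) R).1 w = unitSeries s R w := by
  change unitSeries s R w + ite _ _ _ = _
  rw [h, ite_self, add_zero]

section

variable {R : Type*} [CommRing R] {W : Set (List (Fin s))}

/-- Coefficients at words all of whose shorter words lie in `W`, as a homomorphism on the subgroup
of elements agreeing with the unit on `W`. -/
noncomputable def coeffHom (hW : SubwordClosed W) {J : Type*} (v : J → List (Fin s)) (h2 : ∀ j, 2 ≤ (v j).length)
    (hn : ∀ j, (v j).length ≤ n + 1) (hv : ∀ j, ∀ u : List (Fin s), u.length < (v j).length → u ∈ W) :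
    agreeSubgroup n R hW →* Multiplicative (J → R) :=
  MonoidHom.mk' (fun f => Multiplicative.ofAdd fun j => f.1.1 (v j)) fun f g =>
    congrArg Multiplicative.ofAdd <| funext fun j => mul_apply_of_agree (h2 j) (hn j)
      (fun u hu => f.2 u (hv j u hu)) fun u hu => g.2 u (hv j u hu)

/-- W' enters through an equation, so that both a set of all words up to some length and `insert w
W` can take its place. -/
theorem coeffHom_eq_one {hW : SubwordClosed W} {J : Type*} {v : J → List (Fin s)} {h2 : ∀ j, 2 ≤ (v j).length}
    {hn : ∀ j, (v j).length ≤ n + 1}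
    {hv : ∀ j, ∀ u : List (Fin s), u.length < (v j).length → u ∈ W} {W' : Set (List (Fin s))}
    {hW' : SubwordClosed W'} (hWW' : W' = W ∪ Set.range v) (f : agreeSubgroup n R hW) :
    coeffHom hW v h2 hn hv f = 1 ↔ f.1 ∈ agreeSubgroup n R hW' := by
  subst hWW'
  rw [mem_agreeSubgroup]
  constructor
  · rintro h w (hw | ⟨j, rfl⟩)
    · exact f.2 w hw
    · exact (congrFun (congrArg Multiplicative.toAdd h) j).trans
        (unitSeries_of_length_ne (by have := h2 j; omega)).symm
  · intro h
    exact congrArg Multiplicative.ofAdd <| funext fun j =>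
      (h _ (Or.inr ⟨j, rfl⟩)).trans (unitSeries_of_length_ne (by have := h2 j; omega))

theorem coeffHom_surjective {hW : SubwordClosed W} {J : Type*} {v : J → List (Fin s)} {h2 : ∀ j, 2 ≤ (v j).length}
    {hn : ∀ j, (v j).length ≤ n + 1}
    {hv : ∀ j, ∀ u : List (Fin s), u.length < (v j).length → u ∈ W}
    (hinj : Function.Injective v) (hvW : ∀ j, v j ∉ W) :
    Function.Surjective (coeffHom (n := n) (R := R) hW v h2 hn hv) := by
  intro y
  -- Prescribed values at the words `v j` and 0 elsewhere; as no `v j` is in W, the resulting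
  -- element agrees with the unit on W.
  let a : List (Fin s) → R := Function.extend v (Multiplicative.toAdd y) 0
  refine ⟨⟨addCoeff a, fun w hw => addCoeff_apply_of_eq_zero ?_⟩, ?_⟩
  · exact Function.extend_apply' _ _ _ (by rintro ⟨j, rfl⟩; exact hvW j hw)
  · exact congrArg Multiplicative.ofAdd <| funext fun j =>
      (addCoeff_apply a (h2 j) (hn j)).trans (hinj.extend_apply _ _ j)

/-- The coefficient at a word of length one as a homomorphism. -/
noncomputable def coeffUnitHom (i : Fin s) : G s (n + 1) R →* Rˣ :=
  MonoidHom.mk' (fun f => IsUnit.unit (f.2.2.2 i)) fun f g => by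
    apply Units.ext
    rw [Units.val_mul, IsUnit.unit_spec, IsUnit.unit_spec, IsUnit.unit_spec, mul_apply_singleton]

theorem coeffUnitHom_eq_one {hW : SubwordClosed W} {i : Fin s} {hW' : SubwordClosed (insert [i] W)}
    (f : agreeSubgroup n R hW) : (coeffUnitHom i).comp (agreeSubgroup n R hW).subtype f = 1 ↔ f.1 ∈ agreeSubgroup n R hW' := by
  rw [mem_agreeSubgroup, Units.ext_iff, Units.val_one]
  constructor
  · rintro h w (rfl | hw)
    · exact h
    · exact f.2 w hw
  · exact fun h => h _ (Or.inl rfl)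

theorem coeffUnitHom_surjective (hW : SubwordClosed W) {i : Fin s} (hi : [i] ∉ W) :
    Function.Surjective ((coeffUnitHom i).comp (agreeSubgroup n R hW).subtype) := by
  classical
  intro y
  let f : G s (n + 1) R := ⟨Function.update (unitSeries s R) [i] y, by simp [unitSeries],
    fun v hv => by
      rw [Function.update_of_ne (by rintro rfl; simp at hv), unitSeries_of_length_ne (by omega)],
    fun j => by
      by_cases hj : j = i
      · subst hj; simp
      · rw [Function.update_of_ne (by simpa using hj)]
        exact isUnit_one⟩
  refine ⟨⟨f, fun v hv => ?_⟩, Units.ext ?_⟩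
  · exact Function.update_of_ne (by rintro rfl; exact hi hv) _ _
  · exact Function.update_self [i] (y : R) (unitSeries s R)

end

/-- The factors of the filtration by length. -/
theorem agree_quotient_iso_additive {i : ℕ} (hi : i + 2 ≤ n + 1)
    (h : (agree k n (lengthClosed_length_le s (i + 2)).subwordClosed).IsNormalIn
      (agree k n (lengthClosed_length_le s (i + 1)).subwordClosed)) :
    Nonempty (SubgroupFunctor.quotient _ _ h ≅ additive (s ^ (i + 2))) := by
  -- An arbitrary enumeration of the words of length i + 2; it does not depend on R, so naturality
  -- below is definitional.
  let e : Fin (s ^ (i + 2)) ≃ List.Vector (Fin s) (i + 2) :=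
    (Fintype.equivFinOfCardEq (by rw [card_vector, Fintype.card_fin])).symm
  have he : ∀ j, (e j).1.length = i + 2 := fun j => (e j).2
  refine SubgroupFunctor.quotient_iso h _ (fun R => coeffHom (R := R) (LengthClosed.subwordClosed (lengthClosed_length_le s (i + 1))) (fun j => (e j).1)
    (fun j => by rw [he]; omega) (fun j => by rwa [he])
    fun j u hu => Nat.le_of_lt_succ (by rwa [he] at hu))
    (fun {_ _} _ _ => rfl) (fun R => coeffHom_eq_one (hW' := LengthClosed.subwordClosed (lengthClosed_length_le s (i + 2))) ?_) fun R => coeffHom_surjective ?_ fun j hj => ?_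
  · ext w
    constructor
    · intro hw
      rcases Nat.lt_or_ge w.length (i + 2) with hlt | hge
      · exact Or.inl (Nat.le_of_lt_succ hlt)
      · exact Or.inr ⟨e.symm ⟨w, le_antisymm hw hge⟩,
          congrArg Subtype.val (e.apply_symm_apply _)⟩
    · rintro (hw | ⟨j, rfl⟩)
      · exact Nat.le_succ_of_le hw
      · exact (he j).le
  · exact Subtype.val_injective.comp e.injective
  · have hj : (e j).1.length ≤ i + 1 := hj
    rw [he] at hj
    omega

/-- `𝔾_a` is the one-dimensional case of `𝔾_a^d`. -/
def uniqueAdditiveHom (R : Type*) [CommRing R] : Multiplicative (Unit → R) ≃* Multiplicative R :=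
  AddEquiv.toMultiplicative
    { Equiv.funUnique Unit R with map_add' := fun _ _ => rfl }

theorem agree_quotient_iso_Ga {W : Set (List (Fin s))} (hW : LengthClosed W) {w : List (Fin s)}
    (hw : ∀ u : List (Fin s), u.length < w.length → u ∈ W) (hwW : w ∉ W) (h2 : 2 ≤ w.length)
    (hn : w.length ≤ n + 1)
    (h : (agree k n (hW.insert hw).subwordClosed).IsNormalIn (agree k n hW.subwordClosed)) :
    Nonempty (SubgroupFunctor.quotient _ _ h ≅ Ga) := by
  refine SubgroupFunctor.quotient_iso h _ (fun R =>
    (uniqueAdditiveHom R).toMonoidHom.comp (coeffHom (R := R) hW.subwordClosed (fun _ : Unit => w) (fun _ => h2)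
      (fun _ => hn) fun _ => hw))
    (fun {_ _} _ _ => rfl) (fun R f => ?_) fun R => ?_
  · refine (MulEquiv.map_eq_one_iff (uniqueAdditiveHom R)).trans 
      (coeffHom_eq_one (hW' := (hW.insert hw).subwordClosed) ?_ f)
    rw [Set.range_const, Set.union_comm, Set.insert_eq]
  · exact (uniqueAdditiveHom R).surjective.comp
      (coeffHom_surjective (fun _ _ _ => rfl) fun _ => hwW)

theorem agree_quotient_iso_Gm {W : Set (List (Fin s))} (hW : LengthClosed W) {i : Fin s}
    (hw : ∀ u : List (Fin s), u.length < [i].length → u ∈ W) (hwW : [i] ∉ W)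
    (h : (agree k n (hW.insert hw).subwordClosed).IsNormalIn (agree k n hW.subwordClosed)) :
    Nonempty (SubgroupFunctor.quotient _ _ h ≅ Gm) :=
  SubgroupFunctor.quotient_iso h _ (fun R => (coeffUnitHom i).comp (agreeSubgroup n R hW.subwordClosed).subtype)
    (fun {_ _} _ _ => Units.ext rfl) 
    (fun _ => coeffUnitHom_eq_one (hW' := (hW.insert hw).subwordClosed))
    fun _ => coeffUnitHom_surjective _ hwW

/-- A subnormal series below `agree W`, removing one word at a time. -/
theorem exists_series (N : ℕ) : ∀ (W : Set (List (Fin s))) (hW : LengthClosed W), [] ∈ W →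
    ({w : List (Fin s) | w.length ≤ n + 1} \ W).ncard = N →
    ∃ (m : ℕ) (H : ℕ → SubgroupFunctor (groupLaw k s n).functor),
      H 0 = agree k n hW.subwordClosed ∧
      H m = SubgroupFunctor.trivial (groupLaw k s n).functor ∧
      ∀ i < m, (H (i + 1)).IsClosed ∧ ∃ h : (H (i + 1)).IsNormalIn (H i),
        Nonempty ((H i).quotient (H (i + 1)) h ≅ Ga) ∨
        Nonempty ((H i).quotient (H (i + 1)) h ≅ Gm) := by
  have hfin : ∀ W : Set (List (Fin s)), ({w : List (Fin s) | w.length ≤ n + 1} \ W).Finite :=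
    fun W => (List.finite_length_le (Fin s) (n + 1)).subset Set.sdiff_subset
  induction N with
  | zero =>
    intro W hW _ hN
    rw [Set.ncard_eq_zero (hfin W), Set.sdiff_eq_empty] at hN
    exact ⟨0, fun _ => agree k n hW.subwordClosed, rfl,
      agree_eq_trivial hW.subwordClosed fun w hw => hN hw, fun i hi => absurd hi (by omega)⟩
  | succ N ih =>
    intro W hW h0 hN
    -- A shortest missing word: all shorter words are in W, as the coefficient homomorphisms and
    -- `LengthClosed.insert` require.
    obtain ⟨w, ⟨hwn, hwW⟩, hmin⟩ := Set.exists_min_image _ List.length (hfin W)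
      (Set.nonempty_of_ncard_ne_zero (by omega))
    have hmem : w ∈ {w : List (Fin s) | w.length ≤ n + 1} \ W := ⟨hwn, hwW⟩
    have hwn : w.length ≤ n + 1 := hwn
    have hw : ∀ u : List (Fin s), u.length < w.length → u ∈ W := by
      intro u hu
      by_contra hc
      exact absurd (hmin u ⟨(hu.le.trans hwn : u.length ≤ n + 1), hc⟩) (not_le.2 hu)
    have hN' : ({w : List (Fin s) | w.length ≤ n + 1} \ insert w W).ncard = N := by
      rw [Set.insert_eq, Set.union_comm, ← Set.sdiff_sdiff,
        Set.ncard_sdiff_singleton_of_mem hmem, hN, Nat.add_sub_cancel]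
    obtain ⟨m, H, H0, Hm, HS⟩ := ih _ (hW.insert hw) (Or.inr h0) hN'
    refine ⟨m + 1, fun i => Nat.casesOn i (agree k n hW.subwordClosed) H, rfl, Hm, ?_⟩
    rintro (_ | i) hi
    · change (H 0).IsClosed ∧ ∃ h : (H 0).IsNormalIn (agree k n hW.subwordClosed),
        Nonempty (SubgroupFunctor.quotient _ _ h ≅ Ga) ∨
        Nonempty (SubgroupFunctor.quotient _ _ h ≅ Gm)
      rw [H0]
      refine ⟨agree_isClosed _, agree_isNormalIn _ _ (Set.subset_insert _ _), ?_⟩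
      -- The empty word is in W from the start, so a word of length < 2 is a letter and gives 𝔾_m;
      -- longer words give 𝔾_a.
      rcases Nat.lt_or_ge w.length 2 with h2 | h2
      · match w, h2 with
        | [], _ => exact absurd h0 hwW
        | [i], _ => exact Or.inr (agree_quotient_iso_Gm hW hw hwW _)
      · exact Or.inl (agree_quotient_iso_Ga hW hw hwW h2 hwn _)
    · exact HS i (by omega)

end

/-! ## Representability -/

section

variable (k : Type u) [Field k] (s n : ℕ)

/-- The non-empty words of length at most `n + 1`. -/
abbrev Word : Type := {w : List (Fin s) // w ≠ [] ∧ w.length ≤ n + 1}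

instance : Finite (Word s n) :=
  ((List.finite_length_le (Fin s) (n + 1)).subset fun _ hw => hw.2 :
    {w : List (Fin s) | w ≠ [] ∧ w.length ≤ n + 1}.Finite).to_subtype

/-- A word of length one. -/
def letter (i : Fin s) : Word s n := ⟨[i], by simp⟩

/-- The product of the coordinates at words of length one. -/
noncomputable def letterProd : MvPolynomial (Word s n) k := ∏ i, MvPolynomial.X (letter s n i)

/-- The coordinate ring of `(𝔊ˢ)_{n+1}`. -/
abbrev CoordRing : Type u := Localization.Away (letterProd k s n)

variable {k s n}

/-- The coordinate function at a word. -/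
noncomputable def coord (w : Word s n) : CoordRing k s n :=
  algebraMap (MvPolynomial (Word s n) k) _ (MvPolynomial.X w)

theorem isUnit_coord (i : Fin s) : IsUnit (coord (k := k) (letter s n i)) := by
  have h : IsUnit (algebraMap (MvPolynomial (Word s n) k) (CoordRing k s n) (letterProd k s n)) :=
    IsLocalization.Away.algebraMap_isUnit _
  have h' : IsUnit (∏ i, coord (k := k) (letter s n i)) := by
    refine (congrArg IsUnit ?_).mp h
    exact map_prod _ _ _
  exact IsUnit.prod_univ_iff.1 h' i

theorem coordRing_algHom_ext {R : Type*} [CommRing R] [Algebra k R]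
    {φ ψ : CoordRing k s n →ₐ[k] R} (h : ∀ w, φ (coord w) = ψ (coord w)) : φ = ψ := by
  refine IsLocalization.algHom_ext (A := MvPolynomial (Word s n) k)
    (Submonoid.powers (letterProd k s n)) ?_
  exact MvPolynomial.algHom_ext h

open Classical in
/-- The point of `(𝔊ˢ)_{n+1}(R)` given by a homomorphism from the coordinate ring. -/
noncomputable def pointOfHom {R : Type*} [CommRing R] [Algebra k R]
    (φ : CoordRing k s n →ₐ[k] R) : G s (n + 1) R :=
  ⟨fun w => if h : w ≠ [] ∧ w.length ≤ n + 1 then φ (coord ⟨w, h⟩) else 0,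
    by simp, fun w hw => dif_neg fun h => by omega, fun i => by
      refine (congrArg IsUnit (dif_pos (letter s n i).2)).mpr ?_
      exact (isUnit_coord i).map φ⟩

theorem pointOfHom_apply {R : Type*} [CommRing R] [Algebra k R] (φ : CoordRing k s n →ₐ[k] R)
    (w : Word s n) : (pointOfHom φ).1 w.1 = φ (coord w) :=
  dif_pos w.2

theorem G_ext {R : Type*} [CommRing R] {f g : G s (n + 1) R}
    (h : ∀ w : Word s n, f.1 w.1 = g.1 w.1) : f = g := by
  apply Subtype.ext
  funext w
  by_cases hw : w ≠ [] ∧ w.length ≤ n + 1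
  · exact h ⟨w, hw⟩
  by_cases h0 : w = []
  · rw [h0, f.2.1, g.2.1]
  · have : n + 1 < w.length := by
      by_contra hc
      exact hw ⟨h0, not_lt.1 hc⟩
    rw [f.2.2.1 w this, g.2.2.1 w this]

/-- A point is a free choice of coefficients at the non-empty words of length ≤ n + 1, subject only
to those at letters being invertible; this is the universal property of the localized polynomial
ring. -/
theorem pointOfHom_bijective {R : Type*} [CommRing R] [Algebra k R] :
    Function.Bijective (pointOfHom : (CoordRing k s n →ₐ[k] R) → G s (n + 1) R) := by
  constructor
  · intro φ ψ h
    refine coordRing_algHom_ext fun w => ?_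
    rw [← pointOfHom_apply, ← pointOfHom_apply, h]
  · intro f
    let ψ : MvPolynomial (Word s n) k →ₐ[k] R := MvPolynomial.aeval fun w => f.1 w.1
    have hu : IsUnit (ψ (letterProd k s n)) := by
      rw [letterProd, map_prod, IsUnit.prod_univ_iff]
      intro i
      rw [MvPolynomial.aeval_X]
      exact f.2.2.2 i
    have hψ : ∀ y : Submonoid.powers (letterProd k s n), IsUnit (ψ y) := by
      rintro ⟨_, m, rfl⟩
      rw [map_pow]
      exact hu.pow m
    refine ⟨IsLocalization.liftAlgHom (S := CoordRing k s n) hψ, G_ext fun w => ?_⟩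
    rw [pointOfHom_apply, coord, IsLocalization.liftAlgHom_apply]
    refine (IsLocalization.lift_eq _ _).trans ?_
    exact MvPolynomial.aeval_X _ _

theorem groupLaw_functor_isAlgebraicGroup : IsAlgebraicGroup (groupLaw k s n).functor := by
  refine ⟨CommAlgCat.of k (CoordRing k s n), inferInstanceAs (Algebra.FiniteType k (CoordRing k s n)),
    ⟨Iso.symm (NatIso.ofComponents (fun R => Equiv.toIso (Equiv.ofBijective
      (fun φ : CommAlgCat.of k (CoordRing k s n) ⟶ R => (pointOfHom φ.hom : G s (n + 1) R))
      (pointOfHom_bijective.comp ⟨fun _ _ h => CommAlgCat.hom_ext h,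
        fun φ => ⟨CommAlgCat.ofHom φ, rfl⟩⟩))) ?_)⟩⟩
  intro R S ψ
  ext φ
  refine G_ext fun w => ?_
  refine (pointOfHom_apply _ w).trans ?_
  exact congrArg ψ.hom (pointOfHom_apply φ.hom w).symm

theorem groupLaw_functor_isSplitSolvable : IsSplitSolvable (groupLaw k s n).functor := by
  have h0 : LengthClosed ({[]} : Set (List (Fin s))) := by
    rintro _ rfl u hu
    simp at hu
  -- The series starts at W = {[]}, which imposes no condition: elements of the group and the unit
  -- all vanish at the empty word.
  obtain ⟨m, H, H0, Hm, HS⟩ := exists_series (k := k) (n := n) _ _ h0 rfl rfl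
  refine ⟨groupLaw_functor_isAlgebraicGroup, m, H, H0.trans ?_, Hm, HS⟩
  ext R (f : G s (n + 1) R)
  refine iff_of_true ?_ (Subgroup.mem_top f)
  rintro _ rfl
  exact f.2.1

theorem hasPoints_level (i : ℕ) : (groupLaw k s n).HasPoints
    (agree k n (lengthClosed_length_le s (i + 1)).subwordClosed)
    (fun R => GPlusLevel s (n + 1) (i + 1) R) := by
  intro R f
  rw [mem_agree]
  constructor
  · intro h
    refine ⟨⟨f.2.1, f.2.2.1, fun j => h [j] (by simp)⟩, fun w h2 hw => ?_⟩
    rw [h w hw, unitSeries_of_length_ne (by omega)]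
  · rintro ⟨⟨_, _, h1⟩, h2⟩ w hw
    match w with
    | [] => exact f.2.1
    | [j] => exact h1 j
    | a :: b :: w => exact (h2 _ (by simp) hw).trans (unitSeries_of_length_ne (by simp)).symm

theorem GPlusLevel_one (R : Type*) [CommRing R] : GPlusLevel s n 1 R = GPlus s n R := by
  ext f
  exact ⟨fun h => h.1, fun h => ⟨h, fun w h2 h1 => by omega⟩⟩

end

end BoxedConvolution

/-! ### The main theorem -/

open BoxedConvolution
theorem mainTheorem9 {k : Type u} [Field k] (s n : ℕ) (hn : 1 ≤ n) :
    ∃ L : GroupLaw k s n,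
      (∃ P : ℕ → SubgroupFunctor L.functor,
        L.HasPoints (P 0) (fun R => GPlus s n R) ∧
        (∀ i, 1 ≤ i → i ≤ n - 1 → L.HasPoints (P i) (fun R => GPlusLevel s n (i + 1) R)) ∧
        (∀ i, i ≤ n - 1 → (P i).IsNormalIn (P 0)) ∧
        P (n - 1) = SubgroupFunctor.trivial L.functor ∧
        ∀ i, i + 1 ≤ n - 1 → ∃ h : (P (i + 1)).IsNormalIn (P i),
          Nonempty ((P i).quotient (P (i + 1)) h ≅ additive (s ^ (i + 2)))) ∧
      IsSplitSolvable L.functor := by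
  -- With truncation degree at least 1 the letters survive, so the unit series lies in the group.
  obtain ⟨n, rfl⟩ : ∃ m, n = m + 1 := ⟨n - 1, by omega⟩
  refine ⟨groupLaw k s n,
    ⟨fun i => agree k n (lengthClosed_length_le s (i + 1)).subwordClosed, ?_,
      fun i _ _ => hasPoints_level i, fun i _ => agree_isNormalIn _ _ fun w hw => ?_,
      agree_eq_trivial _ fun w hw => hw, fun i hi => ?_⟩, groupLaw_functor_isSplitSolvable⟩
  -- Level 1 is all of 𝔊ˢ₊, because no length satisfies 2 ≤ |w| ≤ 1.
  · have := hasPoints_level (k := k) (s := s) (n := n) 0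
    simpa only [Nat.zero_add, GPlusLevel_one] using this
  · have hw : w.length ≤ 0 + 1 := hw
    change w.length ≤ i + 1
    omega
  · have h := agree_isNormalIn (k := k) (n := n)
      (lengthClosed_length_le s (i + 1)).subwordClosed
      (lengthClosed_length_le s (i + 2)).subwordClosed fun w hw => Nat.le_succ_of_le hw
    exact ⟨h, agree_quotient_iso_additive (by omega) h⟩
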